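/- **Proposition (Causal equivalence).** Let $U=(X_{i,t})_{i\in\iota,\,t\in\mathbb Z}$, with $\iota$ finite, be a family of real random variables on a probability space, and let $\mathcal G$ be its causal network: the directed acyclic graph with nodes $(i,t)$ that has an edge $(j,t-s)\to(i,t)$, $1\le s\le S$, exactly when the weight $A_{jis}$ of a given real tensor $A$ is nonzero. Suppose that the joint distribution of $U$ is Markovian and faithful with respect to $\mathcal G$, i.e. for all pairwise disjoint finite sets $\mathbf A,\mathbf B,\mathbf C$ of nodes, $\mathbf C$ d-separates $\mathbf A$ and $\mathbf B$ in $\mathcal G$ if and only if the variables in $\mathbf A$ and in $\mathbf B$ are conditionally independent given those in $\mathbf C$. Let $X$ be a variable, let $Y$ be a variable at a strictly earlier time, and let $\mathbf Z\not\ni Y$ be a finite set of variables at times strictly earlier than that of $X$. Assume that $(X,Y,\mathbf Z)$ has a joint Lebesgue density, and that the conditional differential entropies $H(X\mid\mathbf Z)=-E[\log p(X\mid\mathbf Z)]$ and $H(X\mid Y,\mathbf Z)=-E[\log p(X\mid Y,\mathbf Z)]$ are finite. The transfer entropy is $\mathcal T_{Y\to X|\mathbf Z}=H(X\mid\mathbf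 Z)-H(X\mid Y,\mathbf Z)$. Then $$X\perp_{\mathcal G}Y\mid\mathbf Z\iff\mathcal T_{Y\to X|\mathbf Z}=0 .$$ Suppose moreover that the joint samples $(x_m,y_m,\mathbf z_m)_{m\ge0}$, obtained from $(X,Y,\mathbf Z)$ by shifting all times by $m$, form a stationary ergodic sequence. Let $f(x\mid y,\mathbf z;\theta)$, $\theta\in\Theta$, be a family of conditional probability densities, where $\Theta$ is a compact metric space, such that: * $f$ is measurable in $(x,y,\mathbf z)$ and continuous in $\theta$; * almost surely, for all $\theta$, $f(X\mid Y,\mathbf Z;\theta)>0$ and $|\log f(X\mid Y,\mathbf Z;\theta)|\le B(X,Y,\mathbf Z)$, for some $B$ with $B(X,Y,\mathbf Z)$ integrable; * there is a true parameter $\theta^*\in\Theta$, i.e. $f(X\mid Y,\mathbf Z;\theta^*)=p(X\mid Y,\mathbf Z)$ almost surely; * the null set $\Theta_0$ is nonempty, where $\Theta_0$ is the set of all $\theta\in\Theta$ such that $X$ and $Y$ are conditionally independent given $\mathbf Z$ under the law $f(x\mid y,\mathbf z;\theta)\,q(y,\mathbf z)$, and $q$ is the density of $(Y,\mathbf Z)$.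 Let $\mathcal L_k(\theta)=\prod_{m<k}f(x_m\mid y_m,\mathbf z_m;\theta)\,q(y_m,\mathbf z_m)$, let $\hat\theta_{0,k}$ and $\hat\theta_k$ be maximizers of $\mathcal L_k$ over $\Theta_0$ and over $\Theta$ (maximum likelihood estimators), and let $\ell_k(\theta)=\frac1k\sum_{m<k}\log f(x_m\mid y_m,\mathbf z_m;\theta)$. Then, almost surely as $k\to\infty$, $\ell_k(\theta)\to E[\log f(X\mid Y,\mathbf Z;\theta)]$ for each fixed $\theta$ (with an exceptional null set that may depend on $\theta$), and $\ell_k(\hat\theta_k)\to-H(X\mid Y,\mathbf Z)$. The predictability $$\mathcal F_{Y\to X|\mathbf Z}:=\lim_{k\to\infty}-\frac1k\log\frac{\mathcal L_k(\hat\theta_{0,k})}{\mathcal L_k(\hat\theta_k)}$$ exists almost surely as a deterministic number in $[0,\infty)$, and $$\mathcal T_{Y\to X|\mathbf Z}=0\iff\mathcal F_{Y\to X|\mathbf Z}=0 .$$ If, moreover, the null model contains the true conditional law of $X$ given $\mathbf Z$, i.e. $f(X\mid Y,\mathbf Z;\theta)=p(X\mid\mathbf Z)$ almost surely for some $\theta\in\Theta_0$,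 then $\mathcal F_{Y\to X|\mathbf Z}=\mathcal T_{Y\to X|\mathbf Z}$. -/

import Mathlib

open MeasureTheory ProbabilityTheory Filter Topology

noncomputable section

namespace CausalNet

/-! ### The time-lagged causal network and d-separation -/

/-- The causal network of an adjacency tensor. The nodes are the variables `X_{i,t}`, written
`(i, t)`. The weight `A j i s` is the causal effect `X_{j,t-(s+1)} → X_{i,t}`, so that the possible
lags are `1, …, S` and every cause strictly precedes its effect. -/
def network {ι : Type*} {S : ℕ} (A : ι → ι → Fin S → ℝ) : Digraph (ι × ℤ) where
  Adj u v := ∃ s : Fin S, A u.1 v.1 s ≠ 0 ∧ v.2 = u.2 + ((s : ℕ) + 1 : ℤ)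

/-- The vertex number `m` of the path `p` is a v-structure of `p`: it is an interior vertex and
both its neighbours on `p` point to it. -/
def IsCollider {V : Type*} (G : Digraph V) {x y : V} (p : G.toSimpleGraphInclusive.Walk x y)
    (m : ℕ) : Prop :=
  0 < m ∧ m < p.length ∧
    G.Adj (p.getVert (m - 1)) (p.getVert m) ∧ G.Adj (p.getVert (m + 1)) (p.getVert m)

/-- The set `C` blocks the path `p`: some vertex of `p` is either a v-structure such that neither
it nor any of its descendants lies in `C`, or is not a v-structure and lies in `C`. -/
def Blocks {V : Type*} (G : Digraph V) (C : Finset V) {x y : V}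
    (p : G.toSimpleGraphInclusive.Walk x y) : Prop :=
  ∃ m ≤ p.length,
    (IsCollider G p m ∧ ∀ d, Relation.ReflTransGen G.Adj (p.getVert m) d → d ∉ C) ∨
    (¬ IsCollider G p m ∧ p.getVert m ∈ C)

/-- `C` d-separates `A` and `B`: it blocks every path, regardless of the direction of the edges,
from a node of `A` to a node of `B`. -/
def DSep {V : Type*} (G : Digraph V) (A B C : Finset V) : Prop :=
  ∀ x ∈ A, ∀ y ∈ B, ∀ p : G.toSimpleGraphInclusive.Walk x y, p.IsPath → Blocks G C p

/-! ### Conditional independence, Markov property and faithfulness -/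

/-- Under the law `μ` of a triple, the first component is conditionally independent of the second
one given the third one. -/
def CondIndepLaw {α β γ : Type*} [MeasurableSpace α] [MeasurableSpace β] [MeasurableSpace γ]
    [StandardBorelSpace (α × β × γ)] (μ : Measure (α × β × γ)) [IsFiniteMeasure μ] : Prop :=
  CondIndepFun (MeasurableSpace.comap (fun w : α × β × γ => w.2.2) inferInstance)
    (measurable_snd.comp measurable_snd).comap_le
    (fun w : α × β × γ => w.1) (fun w : α × β × γ => w.2.1) μ

/-- The random vector of the variables in `C`. -/
def vec {V Ω : Type*} (U : V → Ω → ℝ) (C : Finset V) (ω : Ω) : C → ℝ := fun v => U v ω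

/-- Conditional independence of the variables in `A` and those in `B` given those in `C`. -/
def CondIndepVars {V Ω : Type*} [MeasurableSpace Ω] (P : Measure Ω) [IsProbabilityMeasure P]
    (U : V → Ω → ℝ) (A B C : Finset V) : Prop :=
  CondIndepLaw (P.map (fun ω => (vec U A ω, vec U B ω, vec U C ω)))

/-- The joint distribution of the variables `U` is Markovian with respect to `G`. -/
def IsMarkovian {V Ω : Type*} [MeasurableSpace Ω] (P : Measure Ω) [IsProbabilityMeasure P]
    (U : V → Ω → ℝ) (G : Digraph V) : Prop :=
  ∀ A B C : Finset V, Disjoint A B → Disjoint A C → Disjoint B C →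
    DSep G A B C → CondIndepVars P U A B C

/-- The joint distribution of the variables `U` is faithful to `G`. -/
def IsFaithful {V Ω : Type*} [MeasurableSpace Ω] (P : Measure Ω) [IsProbabilityMeasure P]
    (U : V → Ω → ℝ) (G : Digraph V) : Prop :=
  ∀ A B C : Finset V, Disjoint A B → Disjoint A C → Disjoint B C →
    CondIndepVars P U A B C → DSep G A B C

/-! ### Conditional entropy and transfer entropy -/

/-- The conditional density `p(x | w) = p(x, w) / p(w)` of a joint law `μ` on `ℝ × γ`. -/
def condDensity {γ : Type*} [MeasureSpace γ] (μ : Measure (ℝ × γ)) (v : ℝ × γ) : ℝ :=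
  (μ.rnDeriv volume v).toReal / ((μ.map Prod.snd).rnDeriv volume v.2).toReal

/-- The conditional (differential) entropy `H(X | W) = - E[log p(X | W)]` of a joint law. -/
def condEntropy {γ : Type*} [MeasureSpace γ] (μ : Measure (ℝ × γ)) : ℝ :=
  - ∫ v, Real.log (condDensity μ v) ∂μ

/-- The conditional entropy of the joint law `μ` is finite. -/
def FiniteCondEntropy {γ : Type*} [MeasureSpace γ] (μ : Measure (ℝ × γ)) : Prop :=
  Integrable (fun v => Real.log (condDensity μ v)) μ

/-- The law of `(X, Z)`. -/
def lawXZ {V Ω : Type*} [MeasurableSpace Ω] (P : Measure Ω) (U : V → Ω → ℝ) (X : V)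
    (Z : Finset V) : Measure (ℝ × (Z → ℝ)) :=
  P.map (fun ω => (U X ω, vec U Z ω))

/-- The law of `(X, Y, Z)`. -/
def lawXYZ {V Ω : Type*} [MeasurableSpace Ω] (P : Measure Ω) (U : V → Ω → ℝ) (X Y : V)
    (Z : Finset V) : Measure (ℝ × ℝ × (Z → ℝ)) :=
  P.map (fun ω => (U X ω, U Y ω, vec U Z ω))

/-- The law of `(Y, Z)`. -/
def lawYZ {V Ω : Type*} [MeasurableSpace Ω] (P : Measure Ω) (U : V → Ω → ℝ) (Y : V)
    (Z : Finset V) : Measure (ℝ × (Z → ℝ)) :=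
  P.map (fun ω => (U Y ω, vec U Z ω))

instance isFiniteMeasure_lawYZ {V Ω : Type*} [MeasurableSpace Ω] (P : Measure Ω)
    [IsFiniteMeasure P] (U : V → Ω → ℝ) (Y : V) (Z : Finset V) :
    IsFiniteMeasure (lawYZ P U Y Z) := by
  unfold lawYZ
  infer_instance

/-- The conditional transfer entropy `T_{Y → X | Z} = H(X | Z) - H(X | Y, Z)`. -/
def transferEntropy {V Ω : Type*} [MeasurableSpace Ω] (P : Measure Ω) (U : V → Ω → ℝ) (X Y : V)
    (Z : Finset V) : ℝ :=
  condEntropy (lawXZ P U X Z) - condEntropy (lawXYZ P U X Y Z)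

/-! ### Joint samples -/

/-- The joint sample number `m` of `(X, Y, Z)`: all variables are shifted by `m` in time, so that
their relative delays are kept. -/
def sample {ι Ω : Type*} (U : ι × ℤ → Ω → ℝ) (X Y : ι × ℤ) (Z : Finset (ι × ℤ)) (m : ℕ) (ω : Ω) :
    ℝ × ℝ × (Z → ℝ) :=
  (U (X.1, X.2 + m) ω, U (Y.1, Y.2 + m) ω, fun z => U (z.1.1, z.1.2 + m) ω)

/-- A sequence of random elements is stationary and ergodic: the shift preserves its law on the
space of sequences, and is ergodic for it. -/
def IsStationaryErgodic {Ω E : Type*} [MeasurableSpace Ω] [MeasurableSpace E] (P : Measure Ω)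
    (W : ℕ → Ω → E) : Prop :=
  Ergodic (fun (w : ℕ → E) (m : ℕ) => w (m + 1)) (P.map (fun ω m => W m ω))

/-! ### Prediction models, likelihood ratio and predictability -/

/-- A parametric prediction model: a family of conditional probability density functions
`f(x | y, z; θ)`; here `γ` is the space of the values `(y, z)`. -/
structure PredictionModel (γ Θ : Type*) [MeasurableSpace γ] where
  /-- `pdf θ (x, y, z)` is `f(x | y, z; θ)`. -/
  pdf : Θ → ℝ × γ → ℝ
  measurable_pdf : ∀ θ, Measurable (pdf θ)
  pdf_nonneg : ∀ θ v, 0 ≤ pdf θ v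
  lintegral_pdf : ∀ θ w, ∫⁻ x, ENNReal.ofReal (pdf θ (x, w)) = 1

/-- The joint law of `(X, Y, Z)` under the parameter `θ`, when `(Y, Z)` has the law `ν`. -/
def PredictionModel.jointLaw {γ Θ : Type*} [MeasurableSpace γ] (M : PredictionModel γ Θ) (θ : Θ)
    (ν : Measure γ) : Measure (ℝ × γ) :=
  ((volume : Measure ℝ).prod ν).withDensity (fun v => ENNReal.ofReal (M.pdf θ v))

instance PredictionModel.isFiniteMeasure_jointLaw {γ Θ : Type*} [MeasurableSpace γ]
    (M : PredictionModel γ Θ) (θ : Θ) (ν : Measure γ) [IsFiniteMeasure ν] :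
    IsFiniteMeasure (M.jointLaw θ ν) := by
  refine ⟨?_⟩
  rw [PredictionModel.jointLaw, withDensity_apply _ MeasurableSet.univ, Measure.restrict_univ,
    lintegral_prod_symm _ ((M.measurable_pdf θ).ennreal_ofReal.aemeasurable)]
  simp [M.lintegral_pdf]

/-- The null set of parameters `Θ₀`: those under which `X` and `Y` are conditionally independent
given `Z`. -/
def nullSet {β δ Θ : Type*} [MeasurableSpace β] [MeasurableSpace δ]
    [StandardBorelSpace (ℝ × β × δ)] (M : PredictionModel (β × δ) Θ) (ν : Measure (β × δ))
    [IsFiniteMeasure ν] : Set Θ :=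
  {θ | CondIndepLaw (M.jointLaw θ ν)}

/-- The likelihood `L_k(θ) = ∏_{m<k} f(x_m | y_m, z_m; θ) q(y_m, z_m)`, where `q` is the density of
the law `ν` of `(Y, Z)`. -/
def likelihood {γ Θ : Type*} [MeasureSpace γ] (M : PredictionModel γ Θ) (ν : Measure γ)
    (w : ℕ → ℝ × γ) (k : ℕ) (θ : Θ) : ℝ :=
  ∏ m ∈ Finset.range k, M.pdf θ (w m) * (ν.rnDeriv volume (w m).2).toReal

/-- The average log-likelihood `(1/k) ∑_{m<k} log f(x_m | y_m, z_m; θ)`, without the term that does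
not depend on `θ`. -/
def avgLogLikelihood {γ Θ : Type*} [MeasurableSpace γ] (M : PredictionModel γ Θ)
    (w : ℕ → ℝ × γ) (k : ℕ) (θ : Θ) : ℝ :=
  (1 / (k : ℝ)) * ∑ m ∈ Finset.range k, Real.log (M.pdf θ (w m))

/-- `θ` is a maximum likelihood estimate in the parameter set `T` from the first `k` samples. -/
def IsMLE {γ Θ : Type*} [MeasureSpace γ] (M : PredictionModel γ Θ) (ν : Measure γ)
    (w : ℕ → ℝ × γ) (k : ℕ) (T : Set Θ) (θ : Θ) : Prop :=
  θ ∈ T ∧ ∀ θ' ∈ T, likelihood M ν w k θ' ≤ likelihood M ν w k θ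

/-- The predictability computed from `k` samples, `- (1/k) log Λ`, where `Λ` is the likelihood
ratio `L_k(θ₀) / L_k(θ₁)` of the estimates `θ₀` in the null model and `θ₁` in the full model. -/
def samplePredictability {γ Θ : Type*} [MeasureSpace γ] (M : PredictionModel γ Θ) (ν : Measure γ)
    (w : ℕ → ℝ × γ) (k : ℕ) (θ₀ θ₁ : Θ) : ℝ :=
  -(1 / (k : ℝ)) * Real.log (likelihood M ν w k θ₀ / likelihood M ν w k θ₁)

/-- `F` is the predictability `F_{Y → X | Z}`: the almost sure limit, as the number of samples
grows, of the predictability computed from the samples `W` with the estimators `θ₀`, `θ₁`. -/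
def IsPredictability {Ω γ Θ : Type*} [MeasurableSpace Ω] [MeasureSpace γ] (P : Measure Ω)
    (M : PredictionModel γ Θ) (ν : Measure γ) (W : ℕ → Ω → ℝ × γ) (θ₀ θ₁ : ℕ → Ω → Θ)
    (F : ℝ) : Prop :=
  ∀ᵐ ω ∂P, Tendsto (fun k => samplePredictability M ν (fun m => W m ω) k (θ₀ k ω) (θ₁ k ω))
    atTop (𝓝 F)

end CausalNet

end

namespace CausalNet

/-! ### The pointwise ergodic theorem -/

/-! Both halves of the statement rest on Gibbs' inequality (`integral_log_le_of_density`): among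
subprobability densities `g`, the mean of `log g` is maximal only at the true density.

Entropy. Relative to Lebesgue measure times the law of (Y, Z), the law of (X, Y, Z) has density p(x
| y, z), and p(x | z) is a competing probability density. The transfer entropy T is the gap between
their mean logarithms, so it vanishes iff the two agree almost surely, which is conditional
independence (`condIndepLaw_iff_condEntropy_sub_eq_zero`). The Markov property and faithfulness
translate this into d-separation.

Likelihood. Let L(θ) = E[log f(X | Y, Z; θ)]. Birkhoff's theorem, domination and compactness of Θ
give almost surely uniform convergence of the average log-likelihoods to L
(`IsStationaryErgodic.ae_tendstoUniformly_average`), so their maxima over Θ and Θ₀ converge to those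
of L. Over Θ the maximum is -H(X | Y, Z), attained at the true parameter. Over Θ₀ it is attained
because Θ₀ is closed: a density not depending on y keeps this property in pointwise limits. The
predictability F is the gap between the two maxima. By the equality case of Gibbs, F = 0 iff some
null parameter reproduces the true law, that is, iff the true law is conditionally independent,
hence iff T = 0. On Θ₀ the density is a function of (x, z), so Gibbs for the law of (X, Z) gives L ≤
-H(X | Z); a null parameter giving p(x | z) attains this bound, and then F = T. -/

/-- The maximum of `0` and of the first `n` Birkhoff sums of `f`. -/
def maxBirkhoff {α : Type*} (T : α → α) (f : α → ℝ) : ℕ → α → ℝ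
  | 0, _ => 0
  | n + 1, x => max 0 (f x + maxBirkhoff T f n (T x))

section Birkhoff

variable {α : Type*} {T : α → α} {f : α → ℝ}

lemma maxBirkhoff_nonneg (n : ℕ) (x : α) : 0 ≤ maxBirkhoff T f n x := by
  cases n with
  | zero => exact le_rfl
  | succ n => exact le_max_left _ _

lemma maxBirkhoff_le_succ (n : ℕ) (x : α) : maxBirkhoff T f n x ≤ maxBirkhoff T f (n + 1) x := by
  induction n generalizing x with
  | zero => exact maxBirkhoff_nonneg 1 x
  | succ n ih => exact max_le_max le_rfl (by linarith [ih (T x)])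

lemma maxBirkhoff_mono (x : α) : Monotone fun n => maxBirkhoff T f n x :=
  monotone_nat_of_le_succ fun n => maxBirkhoff_le_succ n x

lemma birkhoffSum_le_maxBirkhoff (n : ℕ) (x : α) : birkhoffSum T f n x ≤ maxBirkhoff T f n x := by
  induction n generalizing x with
  | zero => simp [maxBirkhoff]
  | succ n ih =>
    rw [birkhoffSum_succ']
    exact (add_le_add le_rfl (ih (T x))).trans (le_max_right _ _)

/-- Passing from `T x` to `x` changes the sums only by the finite term `f x`. The set of points with
bounded maxima is thus invariant, and ergodicity applies to it. -/
lemma bddAbove_maxBirkhoff_comp_iff (x : α) :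
    BddAbove (Set.range fun n => maxBirkhoff T f n (T x)) ↔
      BddAbove (Set.range fun n => maxBirkhoff T f n x) := by
  constructor
  · rintro ⟨C, hC⟩
    refine ⟨max 0 (f x + C), ?_⟩
    rintro _ ⟨n, rfl⟩
    have h := hC ⟨n, rfl⟩
    exact (maxBirkhoff_le_succ n x).trans (max_le_max le_rfl (by simpa using h))
  · rintro ⟨C, hC⟩
    refine ⟨C - f x, ?_⟩
    rintro _ ⟨n, rfl⟩
    have h := (le_max_right _ _).trans (hC ⟨n + 1, rfl⟩)
    show maxBirkhoff T f n (T x) ≤ C - f x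
    linarith

variable [MeasurableSpace α] {μ : Measure α}

lemma integrable_maxBirkhoff (hT : MeasurePreserving T μ μ) (hf : Integrable f μ) (n : ℕ) :
    Integrable (maxBirkhoff T f n) μ := by
  induction n with
  | zero => exact integrable_zero _ _ _
  | succ n ih =>
    exact (integrable_zero _ _ _).sup (hf.add ((hT.integrable_comp ih.1).2 ih))

/-- If `f` has negative mean, then its Birkhoff sums are almost surely bounded above. -/
lemma ae_bddAbove_maxBirkhoff (hT : Ergodic T μ) (hf : Integrable f μ) (hneg : ∫ x, f x ∂μ < 0) :
    ∀ᵐ x ∂μ, BddAbove (Set.range fun n => maxBirkhoff T f n x) := by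
  have hint := integrable_maxBirkhoff hT.toMeasurePreserving hf
  have hmeas : NullMeasurableSet {x | BddAbove (Set.range fun n => maxBirkhoff T f n x)} μ := by
    have : {x | BddAbove (Set.range fun n => maxBirkhoff T f n x)} =
        ⋃ C : ℕ, ⋂ n, {x | maxBirkhoff T f n x ≤ C} := by
      ext x
      simp only [Set.mem_ofPred_eq, Set.mem_iUnion, Set.mem_iInter]
      constructor
      · rintro ⟨C, hC⟩
        obtain ⟨N, hN⟩ := exists_nat_ge C
        exact ⟨N, fun n => (hC ⟨n, rfl⟩).trans hN⟩
      · rintro ⟨N, hN⟩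
        exact ⟨N, by rintro _ ⟨n, rfl⟩; exact hN n⟩
    rw [this]
    exact .iUnion fun C => .iInter fun n =>
      nullMeasurableSet_le (hint n).1.aemeasurable aemeasurable_const
  have hinv : T ⁻¹' {x | BddAbove (Set.range fun n => maxBirkhoff T f n x)} =
      {x | BddAbove (Set.range fun n => maxBirkhoff T f n x)} :=
    Set.ext fun x => bddAbove_maxBirkhoff_comp_iff x
  -- Zero-one law for the invariant set. It remains to refute that the maxima are almost surely
  -- unbounded.
  rcases hT.quasiErgodic.ae_mem_or_ae_notMem₀ hmeas hinv.eventuallyEq with h | h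
  · exact h
  exfalso
  have hcomp (n : ℕ) : Integrable (fun x => maxBirkhoff T f n (T x)) μ :=
    (hT.toMeasurePreserving.integrable_comp (hint n).1).2 (hint n)
  -- The integrand is `max (-maxBirkhoff T f n (T x)) (f x)`: it is bounded by `|f x|`, and equals
  -- `f x` as soon as the maximum at `T x` exceeds `-f x`.
  have hlim : Tendsto (fun n => ∫ x, (maxBirkhoff T f (n + 1) x - maxBirkhoff T f n (T x)) ∂μ)
      atTop (𝓝 (∫ x, f x ∂μ)) := by
    refine tendsto_integral_of_dominated_convergence (fun x => |f x|)
      (fun n => ((hint (n + 1)).sub (hcomp n)).1) hf.abs ?_ ?_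
    · refine fun n => ae_of_all _ fun x => ?_
      have h0 := maxBirkhoff_nonneg (T := T) (f := f) n (T x)
      rw [Real.norm_eq_abs, maxBirkhoff]
      rcases le_total 0 (f x + maxBirkhoff T f n (T x)) with h | h
      · rw [max_eq_right h]; simp
      · rw [max_eq_left h, abs_of_nonpos (by linarith), abs_of_nonpos (by linarith)]; linarith
    · filter_upwards [h] with x hx
      have hx' : ¬ BddAbove (Set.range fun n => maxBirkhoff T f n (T x)) := fun hb =>
        hx ((bddAbove_maxBirkhoff_comp_iff x).1 hb)
      have htop := tendsto_atTop_of_monotone (maxBirkhoff_mono (T := T) (f := f) (T x))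
      rcases htop with htop | ⟨l, hl⟩
      · refine tendsto_const_nhds.congr' ?_
        filter_upwards [htop.eventually_ge_atTop (-f x)] with n hn
        rw [maxBirkhoff, max_eq_right (by linarith)]; ring
      · exact absurd hl.bddAbove_range hx'
  -- Invariance of `μ` removes `T`, and the maxima increase with `n`. So the limit `∫ f` is
  -- nonnegative, a contradiction.
  have hge (n : ℕ) : 0 ≤ ∫ x, (maxBirkhoff T f (n + 1) x - maxBirkhoff T f n (T x)) ∂μ := by
    have hTn : ∫ x, maxBirkhoff T f n (T x) ∂μ = ∫ x, maxBirkhoff T f n x ∂μ := by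
      have := integral_map (μ := μ) (φ := T) hT.measurable.aemeasurable
        (f := maxBirkhoff T f n) (by rw [hT.map_eq]; exact (hint n).1)
      rw [hT.map_eq] at this
      exact this.symm
    rw [integral_sub (hint (n + 1)) (hcomp n), hTn, sub_nonneg]
    exact integral_mono (hint n) (hint (n + 1)) (maxBirkhoff_le_succ n)
  exact absurd (ge_of_tendsto' hlim hge) (not_le.2 hneg)

/-- Subtracting the mean plus `ε / 2` leaves a function of mean `-ε / 2`, whose Birkhoff sums are
bounded by some `C`; the excess `C / n` of the averages is below `ε / 2` for large `n`. -/
lemma ae_eventually_birkhoffAverage_lt [IsProbabilityMeasure μ] (hT : Ergodic T μ)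
    (hf : Integrable f μ) {ε : ℝ} (hε : 0 < ε) :
    ∀ᵐ x ∂μ, ∀ᶠ n in atTop, birkhoffAverage ℝ T f n x < ∫ x, f x ∂μ + ε := by
  set c := ∫ x, f x ∂μ with hc
  have hg : Integrable (fun x => f x - (c + ε / 2)) μ := hf.sub (integrable_const _)
  have hneg : ∫ x, (f x - (c + ε / 2)) ∂μ < 0 := by
    rw [integral_sub hf (integrable_const _)]
    simp [← hc]; linarith
  filter_upwards [ae_bddAbove_maxBirkhoff hT hg hneg] with x ⟨C, hC⟩
  filter_upwards [eventually_gt_atTop 0,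
    (tendsto_natCast_atTop_atTop (R := ℝ)).eventually_gt_atTop (C / (ε / 2))] with n hn hn'
  have hn0 : (0 : ℝ) < n := by exact_mod_cast hn
  have h1 := (birkhoffSum_le_maxBirkhoff n x).trans (hC ⟨n, rfl⟩)
  have h2 : birkhoffSum T (fun x => f x - (c + ε / 2)) n x =
      birkhoffSum T f n x - n * (c + ε / 2) := by
    simp [birkhoffSum, Finset.sum_sub_distrib, mul_add]
  rw [h2] at h1
  rw [div_lt_iff₀ (by positivity)] at hn'
  rw [birkhoffAverage, smul_eq_mul, inv_mul_lt_iff₀ hn0]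
  linarith

/-- **Birkhoff's pointwise ergodic theorem** for an ergodic map of a probability space. -/
theorem ae_tendsto_birkhoffAverage [IsProbabilityMeasure μ] (hT : Ergodic T μ)
    (hf : Integrable f μ) :
    ∀ᵐ x ∂μ, Tendsto (fun n => birkhoffAverage ℝ T f n x) atTop (𝓝 (∫ x, f x ∂μ)) := by
  have hpos (k : ℕ) : (0 : ℝ) < 1 / ((k : ℝ) + 1) := Nat.one_div_pos_of_nat
  have h1 := ae_all_iff.2 fun k : ℕ => ae_eventually_birkhoffAverage_lt hT hf (hpos k)
  have h2 := ae_all_iff.2 fun k : ℕ => ae_eventually_birkhoffAverage_lt hT hf.neg (hpos k)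
  filter_upwards [h1, h2] with x hx1 hx2
  rw [Metric.tendsto_atTop']
  intro ε hε
  obtain ⟨k, hk⟩ := exists_nat_one_div_lt hε
  obtain ⟨N, hN⟩ := eventually_atTop.1 ((hx1 k).and (hx2 k))
  refine ⟨N, fun n hn => ?_⟩
  obtain ⟨ha, hb⟩ := hN n hn.le
  rw [birkhoffAverage_neg] at hb
  simp only [Pi.neg_apply, integral_neg] at hb
  rw [Real.dist_eq, abs_lt]
  constructor <;> linarith

end Birkhoff

/-! ### Stationary ergodic sequences -/

section Samples

variable {Ω E : Type*} [MeasurableSpace Ω] [MeasurableSpace E] {P : Measure Ω}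
  {W : ℕ → Ω → E}

/-- Coordinate `m + 1` is coordinate `m` after the shift, which preserves the law of the whole
sequence. -/
lemma IsStationaryErgodic.map_eq (h : IsStationaryErgodic P W) (hW : ∀ m, Measurable (W m))
    (m : ℕ) : P.map (W m) = P.map (W 0) := by
  have hWm : Measurable fun ω m => W m ω := measurable_pi_lambda _ hW
  have heval (m : ℕ) : P.map (W m) = (P.map fun ω m => W m ω).map fun w => w m := by
    rw [Measure.map_map (measurable_pi_apply m) hWm]
    rfl
  induction m with
  | zero => rfl
  | succ m ih =>
    rw [← ih, heval m, heval (m + 1)]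
    have hE : Ergodic (fun (w : ℕ → E) (m : ℕ) => w (m + 1)) (P.map (fun ω m => W m ω)) := h
    conv_rhs => rw [← hE.toMeasurePreserving.map_eq]
    rw [Measure.map_map (measurable_pi_apply m) hE.measurable]
    rfl

lemma IsStationaryErgodic.ae_forall (h : IsStationaryErgodic P W) (hW : ∀ m, Measurable (W m))
    {p : E → Prop} (hp : ∀ᵐ v ∂(P.map (W 0)), p v) : ∀ᵐ ω ∂P, ∀ m, p (W m ω) := by
  refine ae_all_iff.2 fun m => ?_
  rw [← h.map_eq hW m] at hp
  exact ae_of_ae_map (hW m).aemeasurable hp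

/-- The strong law of large numbers for a stationary ergodic sequence. -/
lemma IsStationaryErgodic.ae_tendsto_average [IsProbabilityMeasure P]
    (h : IsStationaryErgodic P W) (hW : ∀ m, Measurable (W m)) {φ : E → ℝ}
    (hφ : Integrable φ (P.map (W 0))) :
    ∀ᵐ ω ∂P, Tendsto (fun k : ℕ => (1 / (k : ℝ)) * ∑ m ∈ Finset.range k, φ (W m ω)) atTop
      (𝓝 (∫ v, φ v ∂(P.map (W 0)))) := by
  have hWm : Measurable fun ω m => W m ω := measurable_pi_lambda _ hW
  have : IsProbabilityMeasure (P.map fun ω m => W m ω) :=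
    Measure.isProbabilityMeasure_map hWm.aemeasurable
  have heval : P.map (W 0) = (P.map fun ω m => W m ω).map fun w => w 0 := by
    rw [Measure.map_map (measurable_pi_apply 0) hWm]
    rfl
  rw [heval] at hφ ⊢
  -- The observable on sequence space is `φ` of coordinate `0`; its Birkhoff sums along the shift
  -- are the sums of `φ (W m ω)`.
  have hφ' := hφ.comp_measurable (measurable_pi_apply 0)
  rw [integral_map (measurable_pi_apply 0).aemeasurable hφ.1]
  filter_upwards [ae_of_ae_map hWm.aemeasurable (ae_tendsto_birkhoffAverage h hφ')] with ω hω
  refine hω.congr fun k => ?_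
  have hiter (n : ℕ) (w : ℕ → E) :
      (fun (w : ℕ → E) (m : ℕ) => w (m + 1))^[n] w = fun m => w (m + n) := by
    induction n generalizing w with
    | zero => rfl
    | succ n ih =>
      rw [Function.iterate_succ_apply, ih]
      funext m
      congr 1
  simp [birkhoffAverage, birkhoffSum, hiter]

end Samples

/-! ### Uniform law of large numbers and maximum likelihood -/

/-- The modulus of continuity in `θ` of `φ θ v` at scale `1 / (n + 1)`, along a sequence `d`. -/
noncomputable def modulus {E Θ : Type*} [MetricSpace Θ] (φ : Θ → E → ℝ) (d : ℕ → Θ) (n : ℕ)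
    (v : E) : ℝ :=
  ⨆ i : {i : ℕ × ℕ // dist (d i.1) (d i.2) < 1 / ((n : ℝ) + 1)}, |φ (d i.1.1) v - φ (d i.1.2) v|

section Uniform

variable {E Θ : Type*} [MetricSpace Θ] {φ : Θ → E → ℝ} {d : ℕ → Θ}

/-- Taking the supremum over countably many pairs is what makes the modulus measurable. -/
lemma measurable_modulus [MeasurableSpace E] (hφ : ∀ θ, Measurable (φ θ)) (n : ℕ) :
    Measurable (modulus φ d n) :=
  Measurable.iSup fun _ => continuous_abs.measurable.comp ((hφ _).sub (hφ _))

/-- Pairs of points of the dense sequence are dense in the open set of pairs closer than `1 / (n +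
1)`, and the bound is a closed condition on pairs. -/
lemma abs_sub_le_modulus {v : E} {b : ℝ} (hd : DenseRange d) (hb : ∀ θ, |φ θ v| ≤ b)
    (hc : Continuous fun θ => φ θ v) {n : ℕ} {θ θ' : Θ} (h : dist θ θ' < 1 / ((n : ℝ) + 1)) :
    |φ θ v - φ θ' v| ≤ modulus φ d n v := by
  have hbdd : BddAbove (Set.range fun i : {i : ℕ × ℕ // dist (d i.1) (d i.2) < 1 / ((n : ℝ) + 1)} =>
      |φ (d i.1.1) v - φ (d i.1.2) v|) := by
    refine ⟨b + b, ?_⟩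
    rintro _ ⟨i, rfl⟩
    exact (abs_sub _ _).trans (add_le_add (hb _) (hb _))
  have hopen : IsOpen {q : Θ × Θ | dist q.1 q.2 < 1 / ((n : ℝ) + 1)} :=
    isOpen_lt continuous_dist continuous_const
  have hclosed : IsClosed {q : Θ × Θ | |φ q.1 v - φ q.2 v| ≤ modulus φ d n v} :=
    isClosed_le (((hc.comp continuous_fst).sub (hc.comp continuous_snd)).abs) continuous_const
  have hmem := (hd.prodMap hd).open_subset_closure_inter hopen (show (θ, θ') ∈ _ from h)
  refine closure_minimal ?_ hclosed hmem
  rintro _ ⟨hq, ⟨i, rfl⟩⟩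
  exact le_ciSup hbdd ⟨i, hq⟩

lemma abs_modulus_le {v : E} {b : ℝ} (hb0 : 0 ≤ b) (hb : ∀ θ, |φ θ v| ≤ b) (n : ℕ) :
    |modulus φ d n v| ≤ b + b := by
  rw [modulus, abs_of_nonneg (Real.iSup_nonneg fun _ => abs_nonneg _)]
  exact Real.iSup_le (fun i => (abs_sub _ _).trans (add_le_add (hb _) (hb _))) (by linarith)

lemma tendsto_modulus [CompactSpace Θ] {v : E} (hc : Continuous fun θ => φ θ v) :
    Tendsto (fun n => modulus φ d n v) atTop (𝓝 0) := by
  have huc := CompactSpace.uniformContinuous_of_continuous hc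
  rw [Metric.tendsto_atTop]
  intro ε hε
  obtain ⟨δ, hδ, h⟩ := Metric.uniformContinuous_iff.1 huc (ε / 2) (half_pos hε)
  obtain ⟨N, hN⟩ := exists_nat_one_div_lt hδ
  refine ⟨N, fun n hn => ?_⟩
  rw [Real.dist_eq, sub_zero, modulus, abs_of_nonneg (Real.iSup_nonneg fun _ => abs_nonneg _)]
  refine lt_of_le_of_lt (Real.iSup_le (fun i => ?_) (half_pos hε).le) (half_lt_self hε)
  exact (h (i.2.trans_le ((Nat.one_div_le_one_div hn).trans hN.le))).le

variable [MeasurableSpace E] [CompactSpace Θ] {Ω : Type*} [MeasurableSpace Ω] {P : Measure Ω}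
  [IsProbabilityMeasure P] {W : ℕ → Ω → E} {B : E → ℝ}

/-- The **uniform law of large numbers** along a stationary ergodic sequence, for a dominated
family that depends continuously on a parameter in a compact space. -/
theorem IsStationaryErgodic.ae_tendstoUniformly_average [Nonempty Θ]
    (h : IsStationaryErgodic P W) (hW : ∀ m, Measurable (W m)) (hφ : ∀ θ, Measurable (φ θ))
    (hB : Integrable B (P.map (W 0)))
    (hφB : ∀ᵐ v ∂(P.map (W 0)), (∀ θ, |φ θ v| ≤ B v) ∧ Continuous fun θ => φ θ v) :
    Continuous (fun θ => ∫ v, φ θ v ∂(P.map (W 0))) ∧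
    ∀ᵐ ω ∂P, TendstoUniformly
      (fun (k : ℕ) θ => (1 / (k : ℝ)) * ∑ m ∈ Finset.range k, φ θ (W m ω))
      (fun θ => ∫ v, φ θ v ∂(P.map (W 0))) atTop := by
  set μ := P.map (W 0)
  set d := TopologicalSpace.denseSeq Θ
  have hd : DenseRange d := TopologicalSpace.denseRange_denseSeq Θ
  have hint (θ : Θ) : Integrable (φ θ) μ :=
    hB.mono' (hφ θ).aestronglyMeasurable (hφB.mono fun v hv => hv.1 θ)
  have hmodB (n : ℕ) : ∀ᵐ v ∂μ, ‖modulus φ d n v‖ ≤ B v + B v := hφB.mono fun v hv =>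
    abs_modulus_le ((abs_nonneg _).trans (hv.1 (d 0))) hv.1 n
  have hmod (n : ℕ) : Integrable (modulus φ d n) μ :=
    (hB.add hB).mono' (measurable_modulus hφ n).aestronglyMeasurable (hmodB n)
  have hmodlim : Tendsto (fun n => ∫ v, modulus φ d n v ∂μ) atTop (𝓝 0) := by
    have := tendsto_integral_of_dominated_convergence (μ := μ) (F := modulus φ d)
      (f := fun _ => (0 : ℝ)) (fun v => B v + B v) (fun n => (hmod n).1) (hB.add hB) hmodB
      (hφB.mono fun v hv => tendsto_modulus hv.2)
    simpa using this
  refine ⟨continuous_of_dominated (fun θ => (hint θ).1) (fun θ => hφB.mono fun v hv => hv.1 θ) hB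
    (hφB.mono fun v hv => hv.2), ?_⟩
  have hLdiff (n : ℕ) {θ θ' : Θ} (hθ : dist θ θ' < 1 / ((n : ℝ) + 1)) :
      |∫ v, φ θ v ∂μ - ∫ v, φ θ' v ∂μ| ≤ ∫ v, modulus φ d n v ∂μ := by
    rw [← integral_sub (hint θ) (hint θ')]
    refine (abs_integral_le_integral_abs).trans
      (integral_mono_ae ((hint θ).sub (hint θ')).abs (hmod n) ?_)
    exact hφB.mono fun v hv => abs_sub_le_modulus hd hv.1 hv.2 hθ
  -- The law of large numbers is used for countably many functions only, so a single null set
  -- suffices for all `θ`.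
  have h1 := ae_all_iff.2 fun i : ℕ => h.ae_tendsto_average hW (hint (d i))
  have h2 := ae_all_iff.2 fun n : ℕ => h.ae_tendsto_average hW (hmod n)
  filter_upwards [h1, h2, h.ae_forall hW hφB] with ω hω1 hω2 hω3
  rw [Metric.tendstoUniformly_iff]
  intro ε hε
  -- Three errors below `ε / 4` will add up: moving `θ` to a nearby `d i` in the sample average, the
  -- law of large numbers at `d i`, and moving back in the expectation. Compactness leaves finitely
  -- many `d i`.
  obtain ⟨n, hn⟩ := (hmodlim.eventually_lt_const (show 0 < ε / 4 by linarith)).exists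
  have hpos : (0 : ℝ) < 1 / ((n : ℝ) + 1) := Nat.one_div_pos_of_nat
  obtain ⟨t, ht⟩ := isCompact_univ.elim_finite_subcover
    (fun i : ℕ => Metric.ball (d i) (1 / ((n : ℝ) + 1))) (fun i => Metric.isOpen_ball)
    (fun θ _ => by
      obtain ⟨i, hi⟩ := hd.exists_dist_lt θ hpos
      exact Set.mem_iUnion.2 ⟨i, hi⟩)
  have hev1 : ∀ᶠ k : ℕ in atTop, ∀ i ∈ t,
      |(1 / (k : ℝ)) * ∑ m ∈ Finset.range k, φ (d i) (W m ω) - ∫ v, φ (d i) v ∂μ| < ε / 4 := by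
    refine (Finset.eventually_all t).2 fun i _ => ?_
    exact (Metric.tendsto_nhds.1 (hω1 i)) (ε / 4) (by linarith)
  have hev2 := (hω2 n).eventually_lt_const hn
  filter_upwards [hev1, hev2] with k hk1 hk2 θ
  obtain ⟨i, hi, hθ⟩ : ∃ i ∈ t, dist θ (d i) < 1 / ((n : ℝ) + 1) := by
    simpa using ht (Set.mem_univ θ)
  have ha : |(1 / (k : ℝ)) * ∑ m ∈ Finset.range k, φ θ (W m ω) -
      (1 / (k : ℝ)) * ∑ m ∈ Finset.range k, φ (d i) (W m ω)| ≤
      (1 / (k : ℝ)) * ∑ m ∈ Finset.range k, modulus φ d n (W m ω) := by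
    rw [← mul_sub, ← Finset.sum_sub_distrib, abs_mul, abs_of_nonneg (by positivity)]
    refine mul_le_mul_of_nonneg_left ((Finset.abs_sum_le_sum_abs _ _).trans
      (Finset.sum_le_sum fun m _ => ?_)) (by positivity)
    exact abs_sub_le_modulus hd (hω3 m).1 (hω3 m).2 hθ
  have hb := hLdiff n hθ
  have hc := hk1 i hi
  rw [Real.dist_eq, abs_lt]
  rw [abs_le] at ha hb
  rw [abs_lt] at hc
  constructor <;> linarith [ha.1, ha.2, hb.1, hb.2, hc.1, hc.2]

end Uniform

/-- The maximal values of a uniformly convergent sequence of functions converge to the maximal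
value of the limit. -/
lemma tendsto_max_of_tendstoUniformly {Θ : Type*} {ℓ : ℕ → Θ → ℝ} {L : Θ → ℝ}
    (h : TendstoUniformly ℓ L atTop) {T : Set Θ} {θs : Θ} (hθs : θs ∈ T) (hmax : ∀ θ ∈ T, L θ ≤ L θs)
    {θ : ℕ → Θ} (hθ : ∀ᶠ k in atTop, θ k ∈ T ∧ ∀ θ' ∈ T, ℓ k θ' ≤ ℓ k (θ k)) :
    Tendsto (fun k => ℓ k (θ k)) atTop (𝓝 (L θs)) := by
  rw [Metric.tendsto_nhds]
  intro ε hε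
  filter_upwards [Metric.tendstoUniformly_iff.1 h ε hε, hθ] with k hk hkθ
  have h1 := hk θs
  have h2 := hk (θ k)
  rw [Real.dist_eq, abs_lt] at h1 h2 ⊢
  -- Lower bound: `θ k` does at least as well as `θs` for `ℓ k`. Upper bound: `L (θ k) ≤ L θs`.
  constructor <;> linarith [h1.1, h1.2, h2.1, h2.2, hkθ.2 θs hθs, hmax _ hkθ.1]

/-! ### Conditional independence of laws -/

section CondIndep

variable {α β γ : Type*} [MeasurableSpace α] [MeasurableSpace β] [MeasurableSpace γ]

/-- Conditional independence in terms of a regular conditional law `κ` of the second component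
given the third one. -/
theorem condIndepLaw_iff_exists_kernel [StandardBorelSpace α] [Nonempty α] [StandardBorelSpace β]
    [Nonempty β] [StandardBorelSpace (α × β × γ)] (μ : Measure (α × β × γ)) [IsFiniteMeasure μ] :
    CondIndepLaw μ ↔ ∃ κ : Kernel γ β, IsMarkovKernel κ ∧
      ∀ φ : α × β × γ → ENNReal, Measurable φ →
        ∫⁻ v, φ v ∂μ = ∫⁻ v, ∫⁻ y, φ (v.1, y, v.2.2) ∂(κ v.2.2) ∂μ := by
  have hf : Measurable fun w : α × β × γ => w.2.1 := by fun_prop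
  have hg : Measurable fun w : α × β × γ => w.1 := by fun_prop
  have hk : Measurable fun w : α × β × γ => w.2.2 := by fun_prop
  have hkg : Measurable fun w : α × β × γ => (w.2.2, w.1) := by fun_prop
  have hkgf : Measurable fun w : α × β × γ => ((w.2.2, w.1), w.2.1) := by fun_prop
  -- With the coordinates reordered as ((z, x), y), the integral identity says that `κ`, ignoring x,
  -- disintegrates `μ` over (z, x).
  have key (κ : Kernel γ β) [IsMarkovKernel κ] :
      μ.map (fun w => ((w.2.2, w.1), w.2.1)) =
        μ.map (fun w => (w.2.2, w.1)) ⊗ₘ κ.prodMkRight α ↔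
      ∀ φ : α × β × γ → ENNReal, Measurable φ →
        ∫⁻ v, φ v ∂μ = ∫⁻ v, ∫⁻ y, φ (v.1, y, v.2.2) ∂(κ v.2.2) ∂μ := by
    have hR (ψ : (γ × α) × β → ENNReal) (hψ : Measurable ψ) :
        ∫⁻ q, ψ q ∂(μ.map (fun w => (w.2.2, w.1)) ⊗ₘ κ.prodMkRight α) =
          ∫⁻ v, ∫⁻ y, ψ ((v.2.2, v.1), y) ∂(κ v.2.2) ∂μ := by
      rw [Measure.lintegral_compProd hψ, lintegral_map (hψ.lintegral_kernel_prod_right') hkg]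
      rfl
    constructor
    · intro h φ hφ
      have hφ' : Measurable fun q : (γ × α) × β => φ (q.1.2, q.2, q.1.1) := by fun_prop
      have := hR _ hφ'
      rw [← h, lintegral_map hφ' hkgf] at this
      exact this
    · intro h
      refine Measure.ext_of_lintegral _ fun ψ hψ => ?_
      rw [hR ψ hψ, lintegral_map hψ hkgf]
      exact h (fun v => ψ ((v.2.2, v.1), v.2.1)) (by fun_prop)
  have h0 : CondIndepLaw μ ↔ _ := condIndepFun_iff_condDistrib_prod_ae_eq_prodMkRight
    (μ := μ) hf hg hk
  rw [h0]
  rw [condDistrib_ae_eq_iff_measure_eq_compProd _ hf.aemeasurable, key]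
  constructor
  · exact fun h => ⟨_, inferInstance, h⟩
  · rintro ⟨κ, hκ, h⟩
    rw [← key] at h ⊢
    -- Test functions not depending on x show that `κ` is a conditional law of y given z, hence
    -- almost everywhere equal to `condDistrib`.
    have hz : μ.map (fun w => (w.2.2, w.2.1)) = μ.map (fun w => w.2.2) ⊗ₘ κ := by
      refine Measure.ext_of_lintegral _ fun ψ hψ => ?_
      rw [Measure.lintegral_compProd hψ, lintegral_map (hψ.lintegral_kernel_prod_right') hk,
        lintegral_map hψ (hk.prodMk hf)]
      exact (key κ).1 h (fun v => ψ (v.2.2, v.2.1)) (by fun_prop)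
    rw [h]
    refine Measure.compProd_congr ?_
    have hae := condDistrib_ae_eq_of_measure_eq_compProd_of_measurable hk hf hz
    have hm : μ.map (fun w => w.2.2) = (μ.map (fun w => (w.2.2, w.1))).map Prod.fst := by
      rw [Measure.map_map measurable_fst hkg]; rfl
    rw [hm] at hae
    filter_upwards [ae_of_ae_map measurable_fst.aemeasurable hae] with q hq
    exact hq.symm

/-- The conditional law of the image of the second component is the image kernel `κ.map b`, which
still ignores the first component. -/
lemma CondIndepLaw.map {α' β' : Type*} [MeasurableSpace α'] [MeasurableSpace β']
    [StandardBorelSpace α] [Nonempty α] [StandardBorelSpace β] [Nonempty β]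
    [StandardBorelSpace α'] [Nonempty α'] [StandardBorelSpace β'] [Nonempty β']
    [StandardBorelSpace (α × β × γ)] [StandardBorelSpace (α' × β' × γ)]
    {μ : Measure (α × β × γ)} [IsFiniteMeasure μ] (h : CondIndepLaw μ)
    {a : α → α'} {b : β → β'} (ha : Measurable a) (hb : Measurable b) :
    CondIndepLaw (μ.map fun v => (a v.1, b v.2.1, v.2.2)) := by
  obtain ⟨κ, hκ, h⟩ := (condIndepLaw_iff_exists_kernel μ).1 h
  have hm : Measurable fun v : α × β × γ => (a v.1, b v.2.1, v.2.2) := by fun_prop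
  refine (condIndepLaw_iff_exists_kernel _).2
    ⟨κ.map b, Kernel.IsMarkovKernel.map κ hb, fun φ hφ => ?_⟩
  have hφ' : Measurable fun v : α' × β' × γ => ∫⁻ y, φ (v.1, y, v.2.2) ∂(κ.map b v.2.2) :=
    Measurable.lintegral_kernel_prod_right' (κ := (κ.map b).comap (fun v : α' × β' × γ => v.2.2)
      (by fun_prop)) (f := fun q : (α' × β' × γ) × β' => φ (q.1.1, q.2, q.1.2.2)) (by fun_prop)
  rw [lintegral_map hφ hm, lintegral_map hφ' hm]
  refine (h _ (hφ.comp hm)).trans ?_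
  refine lintegral_congr fun v => ?_
  have hφv : Measurable fun y => φ (a v.1, y, v.2.2) := hφ.comp (by fun_prop)
  rw [Kernel.map_apply _ hb, lintegral_map hφv hb]
  rfl

lemma map_prod_skip_middle (ρ : Measure α) [SFinite ρ] (ν : Measure (β × γ)) [SFinite ν] :
    (ρ.prod ν).map (fun v => (v.1, v.2.2)) = ρ.prod (ν.map Prod.snd) := by
  have := Measure.map_prod_map ρ ν (measurable_id (α := α)) (measurable_snd (α := β) (β := γ))
  rw [Measure.map_id] at this
  exact this.symm

/-- A law with a density with respect to the product of a reference measure of the first component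
and the law `ν` of the other ones is conditionally independent iff its density does not depend on
the second component. -/
theorem condIndepLaw_iff_exists_density [StandardBorelSpace α] [Nonempty α] [StandardBorelSpace β]
    [Nonempty β] [StandardBorelSpace (α × β × γ)] (ρ : Measure α) [SigmaFinite ρ]
    (μ : Measure (α × β × γ)) [IsFiniteMeasure μ]
    (hac : μ ≪ ρ.prod (μ.map Prod.snd)) :
    CondIndepLaw μ ↔ ∃ g : α × γ → ENNReal, Measurable g ∧
      μ = (ρ.prod (μ.map Prod.snd)).withDensity fun v => g (v.1, v.2.2) := by
  set ν := μ.map Prod.snd with hν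
  have hmap := map_prod_skip_middle ρ ν
  have hπ : Measurable fun v : α × β × γ => (v.1, v.2.2) := by fun_prop
  have hac' : μ.map (fun v => (v.1, v.2.2)) ≪ ρ.prod (ν.map Prod.snd) := hmap ▸ hac.map hπ
  have hinner (κ : Kernel γ β) [IsMarkovKernel κ] (φ : α × β × γ → ENNReal) (hφ : Measurable φ) :
      Measurable fun w : α × γ => ∫⁻ y, φ (w.1, y, w.2) ∂(κ w.2) :=
    Measurable.lintegral_kernel_prod_right' (κ := κ.comap (fun v : α × γ => v.2)
      measurable_snd) (f := fun q : (α × γ) × β => φ (q.1.1, q.2, q.1.2)) (by fun_prop)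
  -- The weight `g (x, z)` does not see y, so y may be resampled from its conditional law `κ`
  -- without changing the weighted integral.
  have hdis (κ : Kernel γ β) [IsMarkovKernel κ]
      (hκ : ∀ ψ : β × γ → ENNReal, Measurable ψ →
        ∫⁻ w, ψ w ∂ν = ∫⁻ w, ∫⁻ y, ψ (y, w.2) ∂(κ w.2) ∂ν)
      (g : α × γ → ENNReal) (hg : Measurable g) (φ : α × β × γ → ENNReal) (hφ : Measurable φ) :
      ∫⁻ v, g (v.1, v.2.2) * φ v ∂(ρ.prod ν) =
        ∫⁻ v, g (v.1, v.2.2) * ∫⁻ y, φ (v.1, y, v.2.2) ∂(κ v.2.2) ∂(ρ.prod ν) := by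
    have h1 : Measurable fun v : α × β × γ => g (v.1, v.2.2) * φ v := (hg.comp hπ).mul hφ
    have h2 : Measurable fun v : α × β × γ =>
        g (v.1, v.2.2) * ∫⁻ y, φ (v.1, y, v.2.2) ∂(κ v.2.2) :=
      (hg.comp hπ).mul ((hinner κ φ hφ).comp hπ)
    rw [lintegral_prod _ h1.aemeasurable, lintegral_prod _ h2.aemeasurable]
    refine lintegral_congr fun x => ?_
    rw [hκ (fun w => g (x, w.2) * φ (x, w)) (h1.comp measurable_prodMk_left)]
    refine lintegral_congr fun w => ?_
    have h3 : Measurable fun y => φ (x, y, w.2) := hφ.comp (by fun_prop)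
    exact lintegral_const_mul (μ := κ w.2) (g (x, w.2)) h3
  constructor
  · intro h
    obtain ⟨κ, hκ, h⟩ := (condIndepLaw_iff_exists_kernel μ).1 h
    have hκν (ψ : β × γ → ENNReal) (hψ : Measurable ψ) :
        ∫⁻ w, ψ w ∂ν = ∫⁻ w, ∫⁻ y, ψ (y, w.2) ∂(κ w.2) ∂ν := by
      have hψ' : Measurable fun w : β × γ => ∫⁻ y, ψ (y, w.2) ∂(κ w.2) :=
        Measurable.lintegral_kernel_prod_right' (κ := κ.comap (fun v : β × γ => v.2)
          measurable_snd) (f := fun q : (β × γ) × β => ψ (q.2, q.1.2)) (by fun_prop)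
      rw [hν, lintegral_map hψ measurable_snd, lintegral_map hψ' measurable_snd]
      exact h (fun v => ψ v.2) (by fun_prop)
    -- The only candidate is the density of the law of (x, z) with respect to `ρ` times the law of
    -- z.
    refine ⟨(μ.map (fun v => (v.1, v.2.2))).rnDeriv (ρ.prod (ν.map Prod.snd)),
      Measure.measurable_rnDeriv _ _, ?_⟩
    set g := (μ.map (fun v => (v.1, v.2.2))).rnDeriv (ρ.prod (ν.map Prod.snd))
    have hg : Measurable g := Measure.measurable_rnDeriv _ _
    have hgd : μ.map (fun v => (v.1, v.2.2)) = (ρ.prod (ν.map Prod.snd)).withDensity g :=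
      (Measure.withDensity_rnDeriv_eq _ _ hac').symm
    refine Measure.ext_of_lintegral _ fun φ hφ => ?_
    have hΦ := hinner κ φ hφ
    have hgπ : Measurable fun v : α × β × γ => g (v.1, v.2.2) := hg.comp hπ
    rw [h φ hφ, lintegral_withDensity_eq_lintegral_mul _ hgπ hφ]
    have h1 := lintegral_map (μ := μ) hΦ hπ
    rw [hgd, lintegral_withDensity_eq_lintegral_mul _ hg hΦ, ← hmap,
      lintegral_map (hg.mul hΦ) hπ] at h1
    rw [← h1]
    exact (hdis κ hκν g hg φ hφ).symm
  · rintro ⟨g, hg, hμ⟩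
    obtain ⟨κ, hκ, hκν⟩ : ∃ κ : Kernel γ β, IsMarkovKernel κ ∧ ∀ ψ : β × γ → ENNReal,
        Measurable ψ → ∫⁻ w, ψ w ∂ν = ∫⁻ w, ∫⁻ y, ψ (y, w.2) ∂(κ w.2) ∂ν := by
      refine ⟨condDistrib Prod.fst Prod.snd ν, inferInstance, fun ψ hψ => ?_⟩
      have hψ' : Measurable fun q : γ × β => ψ (q.2, q.1) := by fun_prop
      have h1 := lintegral_map (μ := ν) hψ' (measurable_snd.prodMk measurable_fst)
      rw [← compProd_map_condDistrib measurable_fst.aemeasurable, Measure.lintegral_compProd hψ',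
        lintegral_map (hψ'.lintegral_kernel_prod_right') measurable_snd] at h1
      exact h1.symm
    refine (condIndepLaw_iff_exists_kernel μ).2 ⟨κ, hκ, fun φ hφ => ?_⟩
    have hΦ : Measurable fun v : α × β × γ => ∫⁻ y, φ (v.1, y, v.2.2) ∂(κ v.2.2) :=
      (hinner κ φ hφ).comp hπ
    have hgπ : Measurable fun v : α × β × γ => g (v.1, v.2.2) := hg.comp hπ
    rw [hμ, lintegral_withDensity_eq_lintegral_mul _ hgπ hφ,
      lintegral_withDensity_eq_lintegral_mul _ hgπ hΦ]
    exact hdis κ hκν g hg φ hφ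

end CondIndep

/-! ### Gibbs' inequality -/

section Gibbs

variable {E : Type*} [MeasurableSpace E]

/-- **Gibbs' inequality**: among the subprobability densities `g`, the integral of `log g` is
maximal only for the density `p` of the measure. -/
theorem integral_log_le_of_density (lam μ : Measure E) [IsProbabilityMeasure μ] {p g : E → ℝ}
    (hp : Measurable p) (hg : Measurable g) (hg0 : ∀ v, 0 ≤ g v)
    (hμ : μ = lam.withDensity fun v => ENNReal.ofReal (p v))
    (hgint : ∫⁻ v, ENNReal.ofReal (g v) ∂lam ≤ 1) (hgpos : ∀ᵐ v ∂μ, 0 < g v)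
    (hlp : Integrable (fun v => Real.log (p v)) μ) (hlg : Integrable (fun v => Real.log (g v)) μ) :
    ∫ v, Real.log (g v) ∂μ ≤ ∫ v, Real.log (p v) ∂μ ∧
      (∫ v, Real.log (g v) ∂μ = ∫ v, Real.log (p v) ∂μ → g =ᵐ[μ] p) := by
  have hppos : ∀ᵐ v ∂μ, 0 < p v := by
    rw [hμ, ae_withDensity_iff hp.ennreal_ofReal]
    refine ae_of_all _ fun v hv => ?_
    simpa using hv
  -- The mean of `g / p` is the mass of `g` on `{p > 0}`; mass of `g` elsewhere is lost, hence only
  -- an inequality.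
  have hle : ∫⁻ v, ENNReal.ofReal (g v / p v) ∂μ ≤ 1 := by
    refine le_trans ?_ hgint
    have hgp : Measurable fun v => ENNReal.ofReal (g v / p v) := (hg.div hp).ennreal_ofReal
    rw [hμ, lintegral_withDensity_eq_lintegral_mul _ hp.ennreal_ofReal hgp]
    refine lintegral_mono fun v => ?_
    show ENNReal.ofReal (p v) * ENNReal.ofReal (g v / p v) ≤ ENNReal.ofReal (g v)
    rcases le_or_gt (p v) 0 with h | h
    · simp [ENNReal.ofReal_of_nonpos h]
    · rw [← ENNReal.ofReal_mul h.le, mul_div_cancel₀ _ h.ne']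
  have hr0 : 0 ≤ᵐ[μ] fun v => g v / p v := hppos.mono fun v hv => div_nonneg (hg0 v) hv.le
  have hrint : Integrable (fun v => g v / p v) μ := by
    refine ⟨(hg.div hp).aestronglyMeasurable, ?_⟩
    rw [hasFiniteIntegral_iff_ofReal hr0]
    exact hle.trans_lt ENNReal.one_lt_top
  have hr1 : ∫ v, g v / p v ∂μ ≤ 1 := by
    rw [integral_eq_lintegral_of_nonneg_ae hr0 hrint.1]
    exact ENNReal.toReal_le_of_le_ofReal zero_le_one (by simpa using hle)
  -- This is `log r ≤ r - 1` for `r = g / p`. Equality of the two log integrals forces it to be an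
  -- equality almost surely, and then `r = 1`.
  have hpt : ∀ᵐ v ∂μ, 0 ≤ g v / p v - 1 - (Real.log (g v) - Real.log (p v)) := by
    filter_upwards [hppos, hgpos] with v hpv hgv
    rw [← Real.log_div hgv.ne' hpv.ne']
    linarith [Real.log_le_sub_one_of_pos (div_pos hgv hpv)]
  have hint : Integrable (fun v => g v / p v - 1 - (Real.log (g v) - Real.log (p v))) μ :=
    (hrint.sub (integrable_const _)).sub (hlg.sub hlp)
  have heq : ∫ v, (g v / p v - 1 - (Real.log (g v) - Real.log (p v))) ∂μ =
      ∫ v, g v / p v ∂μ - 1 - (∫ v, Real.log (g v) ∂μ - ∫ v, Real.log (p v) ∂μ) := by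
    have hr : Integrable (fun v => g v / p v - 1) μ := hrint.sub (integrable_const _)
    have hl : Integrable (fun v => Real.log (g v) - Real.log (p v)) μ := hlg.sub hlp
    rw [integral_sub hr hl, integral_sub hrint (integrable_const _), integral_sub hlg hlp]
    simp
  have h0 := integral_nonneg_of_ae hpt
  refine ⟨by linarith, fun h => ?_⟩
  have hz := (integral_eq_zero_iff_of_nonneg_ae hpt hint).1 (by linarith)
  filter_upwards [hz, hppos, hgpos] with v hv hpv hgv
  simp only [Pi.zero_apply] at hv
  rw [← Real.log_div hgv.ne' hpv.ne'] at hv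
  by_contra hne
  have hne' : g v / p v ≠ 1 := fun h1 => hne ((div_eq_one_iff_eq hpv.ne').1 h1)
  linarith [Real.log_lt_sub_one_of_pos (div_pos hgv hpv) hne']

/-- A subprobability density that coincides almost surely with the density of a probability
measure is a density of that measure. -/
lemma withDensity_eq_of_ae_eq (lam μ : Measure E) [IsProbabilityMeasure μ] {p g : E → ℝ}
    (hp : Measurable p) (hμ : μ = lam.withDensity fun v => ENNReal.ofReal (p v))
    (hgint : ∫⁻ v, ENNReal.ofReal (g v) ∂lam ≤ 1) (h : g =ᵐ[μ] p) :
    lam.withDensity (fun v => ENNReal.ofReal (g v)) = μ := by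
  -- The density `g` agrees with `p` where `p > 0` and dominates it elsewhere; the total mass leaves
  -- no room for excess.
  have hle : μ ≤ lam.withDensity fun v => ENNReal.ofReal (g v) := by
    conv_lhs => rw [hμ]
    refine withDensity_mono ?_
    rw [hμ, EventuallyEq, ae_withDensity_iff hp.ennreal_ofReal] at h
    filter_upwards [h] with v hv
    by_cases h0 : ENNReal.ofReal (p v) = 0
    · rw [h0]; exact zero_le
    · rw [hv h0]
  have huniv : lam.withDensity (fun v => ENNReal.ofReal (g v)) Set.univ ≤ μ Set.univ := by
    rw [withDensity_apply _ MeasurableSet.univ, Measure.restrict_univ, measure_univ]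
    exact hgint
  exact (Measure.eq_of_le_of_measure_univ_eq hle (le_antisymm (hle _) huniv)).symm

end Gibbs

/-! ### Conditional densities -/

section CondDensity

variable {γ : Type*} [MeasureSpace γ]

@[fun_prop]
lemma measurable_condDensity (μ : Measure (ℝ × γ)) : Measurable (condDensity μ) :=
  (Measure.measurable_rnDeriv _ _).ennreal_toReal.div
    ((Measure.measurable_rnDeriv _ _).ennreal_toReal.comp measurable_snd)

lemma condDensity_nonneg (μ : Measure (ℝ × γ)) (v : ℝ × γ) : 0 ≤ condDensity μ v :=
  div_nonneg ENNReal.toReal_nonneg ENNReal.toReal_nonneg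

lemma map_snd_absolutelyContinuous {μ : Measure (ℝ × γ)} (hac : μ ≪ volume) :
    μ.map Prod.snd ≪ volume :=
  (hac.map measurable_snd).trans Measure.quasiMeasurePreserving_snd.absolutelyContinuous

variable [SigmaFinite (volume : Measure γ)]

/-- The conditional density is the density of the joint law with respect to the product of the
Lebesgue measure and the law of the condition. -/
theorem withDensity_condDensity (μ : Measure (ℝ × γ)) [IsFiniteMeasure μ] (hac : μ ≪ volume) :
    ((volume : Measure ℝ).prod (μ.map Prod.snd)).withDensity
      (fun v => ENNReal.ofReal (condDensity μ v)) = μ := by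
  have hν := map_snd_absolutelyContinuous hac
  set ν := μ.map Prod.snd with hνdef
  set p := μ.rnDeriv volume with hp
  set q := ν.rnDeriv volume with hq
  have hpm : Measurable p := Measure.measurable_rnDeriv _ _
  have hqm : Measurable q := Measure.measurable_rnDeriv _ _
  have hqm' : Measurable fun v : ℝ × γ => q v.2 := hqm.comp measurable_snd
  have hμp : (volume : Measure (ℝ × γ)).withDensity p = μ := Measure.withDensity_rnDeriv_eq _ _ hac
  have hνq : volume.withDensity q = ν := Measure.withDensity_rnDeriv_eq _ _ hν
  have hlam : (volume : Measure ℝ).prod ν =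
      (volume : Measure (ℝ × γ)).withDensity fun v => q v.2 := by
    have : SFinite (volume.withDensity q) := hνq ▸ inferInstance
    rw [← hνq, prod_withDensity_right hqm, Measure.volume_eq_prod]
  -- The quotient `p / q` is harmless: the marginal density `q` vanishes only where `p` does, up to
  -- a null set, so `q * (p / q) = p`.
  have hpos : ∀ᵐ v ∂(volume : Measure (ℝ × γ)), p v ≠ 0 → 0 < q v.2 := by
    rw [← ae_withDensity_iff hpm, hμp]
    exact ae_of_ae_map measurable_snd.aemeasurable (Measure.rnDeriv_pos hν)
  have hptop : ∀ᵐ v ∂(volume : Measure (ℝ × γ)), p v < ⊤ := Measure.rnDeriv_lt_top _ _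
  have hqtop : ∀ᵐ v ∂(volume : Measure (ℝ × γ)), q v.2 < ⊤ :=
    Measure.quasiMeasurePreserving_snd.ae (Measure.rnDeriv_lt_top ν volume)
  rw [hlam, ← withDensity_mul _ hqm' (measurable_condDensity μ).ennreal_ofReal]
  conv_rhs => rw [← hμp]
  refine withDensity_congr_ae ?_
  filter_upwards [hpos, hptop, hqtop] with v h1 h2 h3
  show q v.2 * ENNReal.ofReal ((p v).toReal / (q v.2).toReal) = p v
  by_cases h0 : p v = 0
  · simp [h0]
  · have hq0 := h1 h0
    rw [ENNReal.ofReal_div_of_pos (ENNReal.toReal_pos hq0.ne' h3.ne), ENNReal.ofReal_toReal h2.ne,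
      ENNReal.ofReal_toReal h3.ne, ENNReal.mul_div_cancel hq0.ne' h3.ne]

lemma absolutelyContinuous_prod_map_snd {μ : Measure (ℝ × γ)} [IsFiniteMeasure μ]
    (hac : μ ≪ volume) : μ ≪ (volume : Measure ℝ).prod (μ.map Prod.snd) := by
  conv_lhs => rw [← withDensity_condDensity μ hac]
  exact withDensity_absolutelyContinuous _ _

lemma ae_condDensity_pos {μ : Measure (ℝ × γ)} [IsFiniteMeasure μ] (hac : μ ≪ volume) :
    ∀ᵐ v ∂μ, 0 < condDensity μ v := by
  have h : ∀ᵐ v ∂(((volume : Measure ℝ).prod (μ.map Prod.snd)).withDensity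
      (fun v => ENNReal.ofReal (condDensity μ v))), 0 < condDensity μ v := by
    rw [ae_withDensity_iff (measurable_condDensity μ).ennreal_ofReal]
    exact ae_of_all _ fun v hv => by simpa using hv
  rwa [withDensity_condDensity μ hac] at h

lemma lintegral_condDensity (μ : Measure (ℝ × γ)) [IsProbabilityMeasure μ] (hac : μ ≪ volume) :
    ∫⁻ v, ENNReal.ofReal (condDensity μ v) ∂((volume : Measure ℝ).prod (μ.map Prod.snd)) = 1 := by
  rw [← setLIntegral_univ, ← withDensity_apply _ MeasurableSet.univ,
    withDensity_condDensity μ hac, measure_univ]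

end CondDensity

/-! ### Transfer entropy and conditional independence -/

section TransferEntropy

variable {δ : Type*} [MeasureSpace δ]

/-- The law of the first and third components. -/
noncomputable abbrev skipMiddle (μ : Measure (ℝ × ℝ × δ)) : Measure (ℝ × δ) :=
  μ.map fun v => (v.1, v.2.2)

lemma measurable_skip : Measurable fun v : ℝ × ℝ × δ => (v.1, v.2.2) := by fun_prop

lemma skipMiddle_map_snd (μ : Measure (ℝ × ℝ × δ)) :
    (skipMiddle μ).map Prod.snd = (μ.map Prod.snd).map Prod.snd := by
  rw [Measure.map_map measurable_snd measurable_skip, Measure.map_map measurable_snd measurable_snd]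
  rfl

variable (μ : Measure (ℝ × ℝ × δ)) [IsProbabilityMeasure μ]

lemma map_prod_skip : ((volume : Measure ℝ).prod (μ.map Prod.snd)).map (fun v => (v.1, v.2.2)) =
    (volume : Measure ℝ).prod ((skipMiddle μ).map Prod.snd) := by
  rw [map_prod_skip_middle, skipMiddle_map_snd]

instance : IsProbabilityMeasure (skipMiddle μ) :=
  Measure.isProbabilityMeasure_map measurable_skip.aemeasurable

lemma skipMiddle_absolutelyContinuous
    [SigmaFinite (volume : Measure δ)] {μ : Measure (ℝ × ℝ × δ)} (hac : μ ≪ volume) :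
    skipMiddle μ ≪ volume :=
  (hac.map measurable_skip).trans (QuasiMeasurePreserving.prodMap
    (Measure.QuasiMeasurePreserving.id volume)
    Measure.quasiMeasurePreserving_snd).absolutelyContinuous

variable [SigmaFinite (volume : Measure δ)]

/-- This makes p(x | z), read as a function of (x, y, z), an admissible competitor of p(x | y, z) in
Gibbs' inequality. -/
lemma lintegral_condDensity_skipMiddle (hac : μ ≪ volume) :
    ∫⁻ v, ENNReal.ofReal (condDensity (skipMiddle μ) (v.1, v.2.2))
      ∂((volume : Measure ℝ).prod (μ.map Prod.snd)) = 1 := by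
  rw [← lintegral_condDensity (skipMiddle μ) (skipMiddle_absolutelyContinuous hac),
    ← map_prod_skip, lintegral_map (measurable_condDensity _).ennreal_ofReal measurable_skip]

/-- Conditional independence of the first two components given the third one means that
`p(x | y, z) = p(x | z)`. -/
theorem condIndepLaw_iff_withDensity [StandardBorelSpace (ℝ × ℝ × δ)] (hac : μ ≪ volume) :
    CondIndepLaw μ ↔ ((volume : Measure ℝ).prod (μ.map Prod.snd)).withDensity
      (fun v => ENNReal.ofReal (condDensity (skipMiddle μ) (v.1, v.2.2))) = μ := by
  have hac2 := skipMiddle_absolutelyContinuous hac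
  rw [condIndepLaw_iff_exists_density volume μ (absolutelyContinuous_prod_map_snd hac)]
  constructor
  · rintro ⟨g, hg, h⟩
    conv_rhs => rw [h]
    refine withDensity_congr_ae ?_
    -- Projecting to (x, z) identifies any density `g` that ignores y with p(x | z).
    have h2 : ((volume : Measure ℝ).prod ((skipMiddle μ).map Prod.snd)).withDensity g =
        ((volume : Measure ℝ).prod ((skipMiddle μ).map Prod.snd)).withDensity
          fun v => ENNReal.ofReal (condDensity (skipMiddle μ) v) := by
      rw [withDensity_condDensity _ hac2]
      refine Measure.ext_of_lintegral _ fun φ hφ => ?_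
      have hgπ : Measurable fun v : ℝ × ℝ × δ => g (v.1, v.2.2) := hg.comp measurable_skip
      have hφπ : Measurable fun v : ℝ × ℝ × δ => φ (v.1, v.2.2) := hφ.comp measurable_skip
      have h3 := lintegral_withDensity_eq_lintegral_mul
        ((volume : Measure ℝ).prod (μ.map Prod.snd)) hgπ hφπ
      rw [← h] at h3
      rw [lintegral_withDensity_eq_lintegral_mul _ hg hφ, ← map_prod_skip,
        lintegral_map (hg.mul hφ) measurable_skip, lintegral_map hφ measurable_skip, h3]
      rfl
    rw [withDensity_eq_iff_of_sigmaFinite hg.aemeasurable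
      (measurable_condDensity _).ennreal_ofReal.aemeasurable, ← map_prod_skip] at h2
    filter_upwards [ae_of_ae_map measurable_skip.aemeasurable h2] with v hv
    exact hv.symm
  · intro h
    exact ⟨fun v => ENNReal.ofReal (condDensity (skipMiddle μ) v),
      (measurable_condDensity _).ennreal_ofReal, h.symm⟩

/-- Transfer entropy vanishes iff there is conditional independence. -/
theorem condIndepLaw_iff_condEntropy_sub_eq_zero [StandardBorelSpace (ℝ × ℝ × δ)]
    (hac : μ ≪ volume) (h2 : FiniteCondEntropy (skipMiddle μ)) (h3 : FiniteCondEntropy μ) :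
    CondIndepLaw μ ↔ condEntropy (skipMiddle μ) - condEntropy μ = 0 := by
  have hac2 := skipMiddle_absolutelyContinuous hac
  have hc2 : Measurable fun v : ℝ × ℝ × δ => condDensity (skipMiddle μ) (v.1, v.2.2) :=
    (measurable_condDensity _).comp measurable_skip
  have hμ := (withDensity_condDensity μ hac).symm
  have hint := lintegral_condDensity_skipMiddle μ hac
  have hG := integral_log_le_of_density _ μ (measurable_condDensity μ) hc2
    (fun v => condDensity_nonneg _ _) hμ hint.le
    (ae_of_ae_map measurable_skip.aemeasurable (ae_condDensity_pos hac2)) h3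
    (h2.comp_measurable measurable_skip)
  have hT : condEntropy (skipMiddle μ) =
      -∫ v, Real.log (condDensity (skipMiddle μ) (v.1, v.2.2)) ∂μ := by
    rw [condEntropy, integral_map measurable_skip.aemeasurable h2.1]
  rw [condIndepLaw_iff_withDensity μ hac, hT, condEntropy]
  constructor
  · intro h
    conv_rhs at h => rw [hμ]
    rw [withDensity_eq_iff_of_sigmaFinite hc2.ennreal_ofReal.aemeasurable
      (measurable_condDensity _).ennreal_ofReal.aemeasurable] at h
    have h' : ∀ᵐ v ∂μ, condDensity (skipMiddle μ) (v.1, v.2.2) = condDensity μ v := by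
      filter_upwards [(absolutelyContinuous_prod_map_snd hac).ae_le h] with v hv
      exact (ENNReal.ofReal_eq_ofReal_iff (condDensity_nonneg _ _) (condDensity_nonneg _ _)).1 hv
    rw [integral_congr_ae (h'.mono fun v hv => congrArg Real.log hv)]
    ring
  · intro h
    exact withDensity_eq_of_ae_eq _ μ (measurable_condDensity μ) hμ hint.le
      (hG.2 (by linarith))

end TransferEntropy

/-! ### Likelihoods -/

section Likelihood

variable {γ Θ : Type*} [MeasureSpace γ] (M : PredictionModel γ Θ) (ν : Measure γ) {w : ℕ → ℝ × γ}

lemma likelihood_pos (hf : ∀ m θ, 0 < M.pdf θ (w m))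
    (hq : ∀ m, 0 < (ν.rnDeriv volume (w m).2).toReal) (k : ℕ) (θ : Θ) :
    0 < likelihood M ν w k θ :=
  Finset.prod_pos fun m _ => mul_pos (hf m θ) (hq m)

lemma log_likelihood (hf : ∀ m θ, 0 < M.pdf θ (w m))
    (hq : ∀ m, 0 < (ν.rnDeriv volume (w m).2).toReal) (k : ℕ) (θ : Θ) :
    Real.log (likelihood M ν w k θ) = ∑ m ∈ Finset.range k, Real.log (M.pdf θ (w m)) +
      ∑ m ∈ Finset.range k, Real.log (ν.rnDeriv volume (w m).2).toReal := by
  rw [likelihood, Real.log_prod fun m _ => (mul_pos (hf m θ) (hq m)).ne',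
    ← Finset.sum_add_distrib]
  exact Finset.sum_congr rfl fun m _ => Real.log_mul (hf m θ).ne' (hq m).ne'

lemma IsMLE.avgLogLikelihood_le {M : PredictionModel γ Θ} {ν : Measure γ}
    (hf : ∀ m θ, 0 < M.pdf θ (w m)) (hq : ∀ m, 0 < (ν.rnDeriv volume (w m).2).toReal) {k : ℕ}
    {T : Set Θ} {θ : Θ} (h : IsMLE M ν w k T θ) {θ' : Θ} (hθ' : θ' ∈ T) :
    avgLogLikelihood M w k θ' ≤ avgLogLikelihood M w k θ := by
  have h1 := Real.log_le_log (likelihood_pos M ν hf hq k θ') (h.2 θ' hθ')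
  rw [log_likelihood M ν hf hq, log_likelihood M ν hf hq] at h1
  exact mul_le_mul_of_nonneg_left (by linarith) (by positivity)

/-- The factors `q` do not depend on `θ` and cancel in the likelihood ratio. -/
lemma samplePredictability_eq (hf : ∀ m θ, 0 < M.pdf θ (w m))
    (hq : ∀ m, 0 < (ν.rnDeriv volume (w m).2).toReal) (k : ℕ) (θ₀ θ₁ : Θ) :
    samplePredictability M ν w k θ₀ θ₁ =
      avgLogLikelihood M w k θ₁ - avgLogLikelihood M w k θ₀ := by
  rw [samplePredictability, Real.log_div (likelihood_pos M ν hf hq k θ₀).ne'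
    (likelihood_pos M ν hf hq k θ₁).ne', log_likelihood M ν hf hq, log_likelihood M ν hf hq,
    avgLogLikelihood, avgLogLikelihood]
  ring

end Likelihood

/-! ### Joint laws of a prediction model -/

namespace PredictionModel

lemma lintegral_pdf_prod {γ Θ : Type*} [MeasurableSpace γ] (M : PredictionModel γ Θ) (θ : Θ)
    (ν : Measure γ) [SFinite ν] :
    ∫⁻ v, ENNReal.ofReal (M.pdf θ v) ∂((volume : Measure ℝ).prod ν) = ν Set.univ := by
  rw [lintegral_prod_symm _ (M.measurable_pdf θ).ennreal_ofReal.aemeasurable]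
  simp [M.lintegral_pdf]

lemma jointLaw_map_snd {γ Θ : Type*} [MeasurableSpace γ] (M : PredictionModel γ Θ) (θ : Θ)
    (ν : Measure γ) [SFinite ν] : (M.jointLaw θ ν).map Prod.snd = ν := by
  have hpdf := (M.measurable_pdf θ).ennreal_ofReal
  refine Measure.ext_of_lintegral _ fun φ hφ => ?_
  have hφ' : Measurable fun v : ℝ × γ => φ v.2 := hφ.comp measurable_snd
  rw [lintegral_map hφ measurable_snd, jointLaw,
    lintegral_withDensity_eq_lintegral_mul _ hpdf hφ',
    lintegral_prod_symm _ (hpdf.mul hφ').aemeasurable]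
  refine lintegral_congr fun y => ?_
  have h := lintegral_mul_const (μ := (volume : Measure ℝ)) (φ y)
    (hpdf.comp (measurable_prodMk_right (y := y)))
  refine h.trans ?_
  rw [show ∫⁻ x, (((fun v => ENNReal.ofReal (M.pdf θ v)) ∘ fun x => (x, y)) x) = 1 from
    M.lintegral_pdf θ y, one_mul]

variable {δ Θ : Type*} [MeasurableSpace δ] [StandardBorelSpace (ℝ × ℝ × δ)]
  (M : PredictionModel (ℝ × δ) Θ) (ν : Measure (ℝ × δ)) [IsFiniteMeasure ν]

/-- A parameter belongs to the null set iff its conditional density does not depend on the second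
variable. -/
theorem mem_nullSet_iff (θ : Θ) : θ ∈ nullSet M ν ↔ ∃ g : ℝ × δ → ENNReal, Measurable g ∧
    ∀ᵐ v ∂((volume : Measure ℝ).prod ν), ENNReal.ofReal (M.pdf θ v) = g (v.1, v.2.2) := by
  have hmap := M.jointLaw_map_snd θ ν
  have hpdf := (M.measurable_pdf θ).ennreal_ofReal
  have h := condIndepLaw_iff_exists_density volume (M.jointLaw θ ν)
    (by rw [hmap]; exact withDensity_absolutelyContinuous _ _)
  rw [hmap] at h
  refine h.trans (exists_congr fun g => and_congr_right fun hg => ?_)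
  have hgπ : Measurable fun v : ℝ × ℝ × δ => g (v.1, v.2.2) := hg.comp (by fun_prop)
  rw [jointLaw, withDensity_eq_iff_of_sigmaFinite hpdf.aemeasurable hgπ.aemeasurable]
  rfl

/-- The null set is closed when the model is continuous in the parameter. -/
theorem isClosed_nullSet [TopologicalSpace Θ] [FrechetUrysohnSpace Θ]
    (hM : ∀ v, Continuous fun θ => M.pdf θ v) : IsClosed (nullSet M ν) := by
  refine isClosed_of_closure_subset fun θ hθ => ?_
  obtain ⟨θn, hθn, hlim⟩ := mem_closure_iff_seq_limit.1 hθ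
  choose g hg hfg using fun n => (M.mem_nullSet_iff ν (θn n)).1 (hθn n)
  -- The limsup is measurable and ignores y everywhere, and it equals the limit density wherever all
  -- the `g n` represent their models.
  refine (M.mem_nullSet_iff ν θ).2
    ⟨fun u => limsup (fun n => g n u) atTop, Measurable.limsup hg, ?_⟩
  filter_upwards [ae_all_iff.2 hfg] with v hv
  have h1 : Tendsto (fun n => ENNReal.ofReal (M.pdf (θn n) v)) atTop
      (𝓝 (ENNReal.ofReal (M.pdf θ v))) :=
    ENNReal.tendsto_ofReal (((hM v).tendsto θ).comp hlim)
  simp only [hv] at h1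
  exact h1.limsup_eq.symm

end PredictionModel

/-- The finiteness instances depend on the measure, so equal measures are exchanged by substitution.
-/
lemma condIndepLaw_congr {α β γ : Type*} [MeasurableSpace α] [MeasurableSpace β]
    [MeasurableSpace γ] [StandardBorelSpace (α × β × γ)] {μ μ' : Measure (α × β × γ)}
    [IsFiniteMeasure μ] [IsFiniteMeasure μ'] (h : μ = μ') : CondIndepLaw μ ↔ CondIndepLaw μ' := by
  subst h
  rfl

/-! ### Expected log-likelihood -/

section ExpectedLogLikelihood

variable {δ Θ : Type*} [MeasureSpace δ] [SigmaFinite (volume : Measure δ)]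
  (μ : Measure (ℝ × ℝ × δ)) [IsProbabilityMeasure μ] (M : PredictionModel (ℝ × δ) Θ)

/-- The expected log-likelihood is at most minus the conditional entropy, with equality only for
the parameters that give the true law. -/
theorem integral_log_pdf_le (hac : μ ≪ volume) (h3 : FiniteCondEntropy μ) {θ : Θ}
    (hpos : ∀ᵐ v ∂μ, 0 < M.pdf θ v) (hint : Integrable (fun v => Real.log (M.pdf θ v)) μ) :
    ∫ v, Real.log (M.pdf θ v) ∂μ ≤ -condEntropy μ ∧
      (∫ v, Real.log (M.pdf θ v) ∂μ = -condEntropy μ → M.jointLaw θ (μ.map Prod.snd) = μ) := by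
  have hμ := (withDensity_condDensity μ hac).symm
  have := Measure.isProbabilityMeasure_map (μ := μ) (f := Prod.snd) measurable_snd.aemeasurable
  have h1 : ∫⁻ v, ENNReal.ofReal (M.pdf θ v) ∂((volume : Measure ℝ).prod (μ.map Prod.snd)) ≤ 1 := by
    rw [M.lintegral_pdf_prod, measure_univ]
  have hG := integral_log_le_of_density _ μ (measurable_condDensity μ) (M.measurable_pdf θ)
    (M.pdf_nonneg θ) hμ h1 hpos h3 hint
  rw [condEntropy, neg_neg]
  exact ⟨hG.1, fun h => withDensity_eq_of_ae_eq _ μ (measurable_condDensity μ) hμ h1 (hG.2 h)⟩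

/-- In the null model, the expected log-likelihood is at most minus the conditional entropy of the
first variable given the third one. -/
theorem integral_log_pdf_le_of_mem_nullSet [StandardBorelSpace (ℝ × ℝ × δ)] (hac : μ ≪ volume)
    (h2 : FiniteCondEntropy (skipMiddle μ)) {θ : Θ} (hθ : θ ∈ nullSet M (μ.map Prod.snd))
    (hpos : ∀ᵐ v ∂μ, 0 < M.pdf θ v) (hint : Integrable (fun v => Real.log (M.pdf θ v)) μ) :
    ∫ v, Real.log (M.pdf θ v) ∂μ ≤ -condEntropy (skipMiddle μ) := by
  have hac2 := skipMiddle_absolutelyContinuous hac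
  have := Measure.isProbabilityMeasure_map (μ := μ) (f := Prod.snd) measurable_snd.aemeasurable
  obtain ⟨g, hg, hfg⟩ := (M.mem_nullSet_iff _ θ).1 hθ
  have hgr : Measurable fun u => (g u).toReal := hg.ennreal_toReal
  have hfgμ : ∀ᵐ v ∂μ, M.pdf θ v = (g (v.1, v.2.2)).toReal := by
    filter_upwards [(absolutelyContinuous_prod_map_snd hac).ae_le hfg] with v hv
    rw [← hv, ENNReal.toReal_ofReal (M.pdf_nonneg θ v)]
  have hlog : (fun v => Real.log (M.pdf θ v)) =ᵐ[μ]
      fun v => Real.log (g (v.1, v.2.2)).toReal := hfgμ.mono fun v hv => congrArg Real.log hv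
  -- From here on the problem lives on (x, z), where `g` is a subprobability density competing with
  -- p(x | z).
  have hlogm : Measurable fun u => Real.log (g u).toReal := Real.measurable_log.comp hgr
  have hgint : ∫⁻ u, ENNReal.ofReal (g u).toReal
      ∂((volume : Measure ℝ).prod ((skipMiddle μ).map Prod.snd)) ≤ 1 := by
    refine (lintegral_mono fun u => ENNReal.ofReal_toReal_le).trans ?_
    rw [← map_prod_skip, lintegral_map hg measurable_skip, ← lintegral_congr_ae hfg,
      M.lintegral_pdf_prod, measure_univ]
  have hG := (integral_log_le_of_density _ (skipMiddle μ) (measurable_condDensity (skipMiddle μ))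
    hgr (fun u => ENNReal.toReal_nonneg) (withDensity_condDensity _ hac2).symm hgint ?_ h2 ?_).1
  · rw [condEntropy, neg_neg, integral_congr_ae hlog]
    rwa [integral_map measurable_skip.aemeasurable hlogm.aestronglyMeasurable] at hG
  · rw [ae_map_iff measurable_skip.aemeasurable (measurableSet_lt measurable_const hgr)]
    filter_upwards [hfgμ, hpos] with v hv hp
    rwa [← hv]
  · rw [integrable_map_measure hlogm.aestronglyMeasurable measurable_skip.aemeasurable]
    exact hint.congr hlog

end ExpectedLogLikelihood

/-! ### The laws of the variables of a system -/

section Laws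

variable {V Ω : Type*} [MeasurableSpace Ω] (P : Measure Ω) {U : V → Ω → ℝ}

lemma measurable_vec (hU : ∀ v, Measurable (U v)) (C : Finset V) : Measurable (vec U C) :=
  measurable_pi_lambda _ fun v => hU v

lemma measurable_XYZ (hU : ∀ v, Measurable (U v)) (X Y : V) (Z : Finset V) :
    Measurable fun ω => (U X ω, U Y ω, vec U Z ω) :=
  (hU X).prodMk ((hU Y).prodMk (measurable_vec hU Z))

lemma isProbabilityMeasure_lawXYZ [IsProbabilityMeasure P] (hU : ∀ v, Measurable (U v)) (X Y : V)
    (Z : Finset V) :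
    IsProbabilityMeasure (lawXYZ P U X Y Z) :=
  Measure.isProbabilityMeasure_map (measurable_XYZ hU X Y Z).aemeasurable

lemma skipMiddle_lawXYZ (hU : ∀ v, Measurable (U v)) (X Y : V) (Z : Finset V) :
    skipMiddle (lawXYZ P U X Y Z) = lawXZ P U X Z := by
  rw [skipMiddle, lawXYZ, Measure.map_map measurable_skip (measurable_XYZ hU X Y Z)]
  rfl

lemma map_snd_lawXYZ (hU : ∀ v, Measurable (U v)) (X Y : V) (Z : Finset V) :
    (lawXYZ P U X Y Z).map Prod.snd = lawYZ P U Y Z := by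
  rw [lawXYZ, Measure.map_map measurable_snd (measurable_XYZ hU X Y Z)]
  rfl

/-- A vector indexed by a singleton and its only entry are measurable functions of each other, so
`CondIndepLaw.map` applies in both directions. -/
lemma condIndepVars_singleton_iff [IsProbabilityMeasure P] (hU : ∀ v, Measurable (U v)) (X Y : V)
    (Z : Finset V) [IsFiniteMeasure (lawXYZ P U X Y Z)] :
    CondIndepVars P U {X} {Y} Z ↔ CondIndepLaw (lawXYZ P U X Y Z) := by
  have hX : X ∈ ({X} : Finset V) := Finset.mem_singleton_self X
  have hY : Y ∈ ({Y} : Finset V) := Finset.mem_singleton_self Y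
  have hvec : Measurable fun ω => (vec U {X} ω, vec U {Y} ω, vec U Z ω) :=
    (measurable_vec hU _).prodMk ((measurable_vec hU _).prodMk (measurable_vec hU _))
  have ha (X : V) (hX : X ∈ ({X} : Finset V)) :
      Measurable fun u : ({X} : Finset V) → ℝ => u ⟨X, hX⟩ := measurable_pi_apply _
  have hc (X : V) : Measurable fun (x : ℝ) (_ : ({X} : Finset V)) => x :=
    measurable_pi_lambda _ fun _ => measurable_id
  have hconst (X : V) (ω : Ω) : (fun _ : ({X} : Finset V) => U X ω) = vec U {X} ω := by
    funext v
    rw [vec, Finset.mem_singleton.1 v.2]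
  constructor
  · intro h
    refine (condIndepLaw_congr ?_).1 (CondIndepLaw.map h (ha X hX) (ha Y hY))
    rw [Measure.map_map (by fun_prop) hvec]
    rfl
  · intro h
    refine (condIndepLaw_congr ?_).1 (CondIndepLaw.map h (hc X) (hc Y))
    rw [lawXYZ, Measure.map_map (by fun_prop) (measurable_XYZ hU X Y Z)]
    congr 1
    funext ω
    simp only [Function.comp_apply, hconst]

end Laws

lemma measurable_sample {ι Ω : Type*} [MeasurableSpace Ω] {U : ι × ℤ → Ω → ℝ}
    (hU : ∀ v, Measurable (U v)) (X Y : ι × ℤ) (Z : Finset (ι × ℤ)) (m : ℕ) :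
    Measurable (sample U X Y Z m) :=
  (hU _).prodMk ((hU _).prodMk (measurable_pi_lambda _ fun _ => hU _))

lemma map_sample_zero {ι Ω : Type*} [MeasurableSpace Ω] (P : Measure Ω) (U : ι × ℤ → Ω → ℝ)
    (X Y : ι × ℤ) (Z : Finset (ι × ℤ)) : P.map (sample U X Y Z 0) = lawXYZ P U X Y Z := by
  have : sample U X Y Z 0 = fun ω => (U X ω, U Y ω, vec U Z ω) := by
    funext ω
    simp only [sample, Nat.cast_zero, add_zero]
    rfl
  rw [lawXYZ, this]

/-! ### Asymptotics of maximum likelihood -/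

section Asymptotics

variable {Ω δ Θ : Type*} [MeasurableSpace Ω] [MeasureSpace δ] [SigmaFinite (volume : Measure δ)]
  [StandardBorelSpace (ℝ × ℝ × δ)] [MetricSpace Θ] [CompactSpace Θ]
  {P : Measure Ω} [IsProbabilityMeasure P] {W : ℕ → Ω → ℝ × ℝ × δ}
  {μ : Measure (ℝ × ℝ × δ)} [IsProbabilityMeasure μ] {M : PredictionModel (ℝ × δ) Θ}

/-- Consistency of the likelihood ratio statistic along a stationary ergodic sequence of samples
of the law `μ`, where `ν` is the law of the conditioning variables. -/
theorem predictability_of_isStationaryErgodic (h : IsStationaryErgodic P W)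
    (hW : ∀ m, Measurable (W m)) (hμ : P.map (W 0) = μ) {ν : Measure (ℝ × δ)} [IsFiniteMeasure ν]
    (hν : μ.map Prod.snd = ν) (hac : μ ≪ volume)
    (h2 : FiniteCondEntropy (skipMiddle μ)) (h3 : FiniteCondEntropy μ)
    (hM : ∀ v, Continuous fun θ => M.pdf θ v) {B : ℝ × ℝ × δ → ℝ} (hB : Integrable B μ)
    (hMB : ∀ᵐ v ∂μ, ∀ θ, 0 < M.pdf θ v ∧ |Real.log (M.pdf θ v)| ≤ B v) {θs : Θ}
    (hθs : ∀ᵐ v ∂μ, M.pdf θs v = condDensity μ v)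
    (hne : (nullSet M ν).Nonempty) {θ₀ θ₁ : ℕ → Ω → Θ}
    (hθ₀ : ∀ᵐ ω ∂P, ∀ k, IsMLE M ν (fun m => W m ω) k
      (nullSet M ν) (θ₀ k ω))
    (hθ₁ : ∀ᵐ ω ∂P, ∀ k, IsMLE M ν (fun m => W m ω) k Set.univ (θ₁ k ω)) :
    (∀ θ, ∀ᵐ ω ∂P, Tendsto (fun k => avgLogLikelihood M (fun m => W m ω) k θ) atTop
      (𝓝 (∫ v, Real.log (M.pdf θ v) ∂μ))) ∧
    (∀ᵐ ω ∂P, Tendsto (fun k => avgLogLikelihood M (fun m => W m ω) k (θ₁ k ω)) atTop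
      (𝓝 (-condEntropy μ))) ∧
    ∃ F : ℝ, IsPredictability P M ν W θ₀ θ₁ F ∧ 0 ≤ F ∧
      (condEntropy (skipMiddle μ) - condEntropy μ = 0 ↔ F = 0) ∧
      ((∃ θ ∈ nullSet M ν, ∀ᵐ v ∂μ,
        M.pdf θ v = condDensity (skipMiddle μ) (v.1, v.2.2)) →
          F = condEntropy (skipMiddle μ) - condEntropy μ) := by
  subst hν
  have hΘ : Nonempty Θ := ⟨θs⟩
  have hlogm (θ : Θ) : Measurable fun v => Real.log (M.pdf θ v) :=
    Real.measurable_log.comp (M.measurable_pdf θ)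
  have hint (θ : Θ) : Integrable (fun v => Real.log (M.pdf θ v)) μ :=
    hB.mono' (hlogm θ).aestronglyMeasurable (hMB.mono fun v hv => (hv θ).2)
  have hpos (θ : Θ) : ∀ᵐ v ∂μ, 0 < M.pdf θ v := hMB.mono fun v hv => (hv θ).1
  have hgibbs (θ : Θ) := integral_log_pdf_le μ M hac h3 (hpos θ) (hint θ)
  have hLs : ∫ v, Real.log (M.pdf θs v) ∂μ = -condEntropy μ := by
    rw [condEntropy, neg_neg]
    exact integral_congr_ae (hθs.mono fun v hv => congrArg Real.log hv)
  -- Along the samples `q` is positive and finite, so likelihoods are positive and their logarithms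
  -- split.
  have hq : ∀ᵐ v ∂μ, 0 < ((μ.map Prod.snd).rnDeriv volume v.2).toReal := by
    have := map_snd_absolutelyContinuous hac
    refine ae_of_ae_map measurable_snd.aemeasurable
      (p := fun y => 0 < ((μ.map Prod.snd).rnDeriv volume y).toReal) ?_
    filter_upwards [Measure.rnDeriv_pos this,
      this.ae_le (Measure.rnDeriv_lt_top (μ.map Prod.snd) volume)] with y h1 h2
    exact ENNReal.toReal_pos h1.ne' h2.ne
  obtain ⟨hLcont, hunif⟩ := h.ae_tendstoUniformly_average
    (φ := fun θ v => Real.log (M.pdf θ v)) hW hlogm (B := B) (hμ ▸ hB) (by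
      rw [hμ]
      filter_upwards [hMB] with v hv
      exact ⟨fun θ => (hv θ).2, (hM v).log fun θ => (hv θ).1.ne'⟩)
  rw [hμ] at hLcont hunif
  have hpath : ∀ᵐ ω ∂P, ∀ m, (∀ θ, 0 < M.pdf θ (W m ω)) ∧
      0 < ((μ.map Prod.snd).rnDeriv volume (W m ω).2).toReal := by
    refine h.ae_forall hW (p := fun v => (∀ θ, 0 < M.pdf θ v) ∧
      0 < ((μ.map Prod.snd).rnDeriv volume v.2).toReal) ?_
    rw [hμ]
    filter_upwards [hMB, hq] with v hv hqv
    exact ⟨fun θ => (hv θ).1, hqv⟩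
  have hlim₁ : ∀ᵐ ω ∂P, Tendsto (fun k => avgLogLikelihood M (fun m => W m ω) k (θ₁ k ω)) atTop
      (𝓝 (-condEntropy μ)) := by
    filter_upwards [hunif, hpath, hθ₁] with ω hu hp hmle
    rw [← hLs]
    refine tendsto_max_of_tendstoUniformly hu (Set.mem_univ θs)
      (fun θ _ => hLs ▸ (hgibbs θ).1) (Eventually.of_forall fun k => ⟨Set.mem_univ _, ?_⟩)
    exact fun θ' hθ' => (hmle k).avgLogLikelihood_le (fun m => (hp m).1) (fun m => (hp m).2) hθ'
  obtain ⟨θm, hθm, hmax⟩ := (M.isClosed_nullSet (μ.map Prod.snd) hM).isCompact.exists_isMaxOn hne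
    hLcont.continuousOn
  have hmax' : ∀ θ ∈ nullSet M (μ.map Prod.snd),
      ∫ v, Real.log (M.pdf θ v) ∂μ ≤ ∫ v, Real.log (M.pdf θm v) ∂μ := fun θ hθ => hmax hθ
  -- For a parameter reproducing `μ`, lying in the null set is conditional independence of `μ`
  -- itself.
  have hjoint (θ : Θ) (hθ : M.jointLaw θ (μ.map Prod.snd) = μ) :
      θ ∈ nullSet M (μ.map Prod.snd) ↔ condEntropy (skipMiddle μ) - condEntropy μ = 0 :=
    (condIndepLaw_congr hθ).trans (condIndepLaw_iff_condEntropy_sub_eq_zero μ hac h2 h3)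
  refine ⟨fun θ => hunif.mono fun ω hω => hω.tendsto_at θ, hlim₁,
    -condEntropy μ - ∫ v, Real.log (M.pdf θm v) ∂μ, ?_, by linarith [(hgibbs θm).1], ?_, ?_⟩
  · filter_upwards [hunif, hpath, hθ₀, hlim₁] with ω hu hp hmle hl₁
    refine (hl₁.sub (tendsto_max_of_tendstoUniformly hu hθm hmax' (θ := fun k => θ₀ k ω)
      (Eventually.of_forall fun k => ⟨(hmle k).1, ?_⟩))).congr fun k => ?_
    · exact fun θ' hθ' => (hmle k).avgLogLikelihood_le (fun m => (hp m).1) (fun m => (hp m).2) hθ'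
    · exact (samplePredictability_eq M _ (fun m => (hp m).1) (fun m => (hp m).2) k _ _).symm
  -- If T = 0, the true parameter is null, so the maximum over the null set is already -H(X | Y, Z).
  -- Conversely F = 0 is the equality case of Gibbs at the null maximizer `θm`, which then
  -- reproduces `μ`.
  · constructor
    · intro hT
      have hs := hmax' θs ((hjoint θs ((hgibbs θs).2 hLs)).2 hT)
      linarith [(hgibbs θm).1]
    · intro hF
      exact (hjoint θm ((hgibbs θm).2 (by linarith))).1 hθm
  · rintro ⟨θ, hθ, hθeq⟩
    have hLθ : ∫ v, Real.log (M.pdf θ v) ∂μ = -condEntropy (skipMiddle μ) := by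
      rw [condEntropy, neg_neg, integral_map measurable_skip.aemeasurable h2.1]
      exact integral_congr_ae (hθeq.mono fun v hv => congrArg Real.log hv)
    have hle := integral_log_pdf_le_of_mem_nullSet μ M hac h2 hθm (hpos θm) (hint θm)
    linarith [hmax' θ hθ]

end Asymptotics

end CausalNet

/-! ### Causal equivalence: d-separation, transfer entropy and predictability -/

theorem mainTheorem3 {ι Ω Θ : Type*} [Fintype ι] [MeasurableSpace Ω]
    [MetricSpace Θ] [CompactSpace Θ]
    -- the system and its causal network
    (P : Measure Ω) [IsProbabilityMeasure P]
    (U : ι × ℤ → Ω → ℝ) (hU : ∀ v, Measurable (U v))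
    {S : ℕ} (A : ι → ι → Fin S → ℝ)
    (hMarkov : CausalNet.IsMarkovian P U (CausalNet.network A))
    (hFaithful : CausalNet.IsFaithful P U (CausalNet.network A))
    -- the target `X`, the source `Y` and the conditioning set `Z`
    (X Y : ι × ℤ) (Z : Finset (ι × ℤ)) (hYX : Y.2 < X.2) (hZX : ∀ z ∈ Z, z.2 < X.2) (hYZ : Y ∉ Z)
    -- a joint density and finite conditional entropies
    (hac : CausalNet.lawXYZ P U X Y Z ≪ volume)
    (hHXZ : CausalNet.FiniteCondEntropy (CausalNet.lawXZ P U X Z))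
    (hHXYZ : CausalNet.FiniteCondEntropy (CausalNet.lawXYZ P U X Y Z)) :
    -- d-separation is equivalent to zero transfer entropy
    (CausalNet.DSep (CausalNet.network A) {X} {Y} Z ↔
      CausalNet.transferEntropy P U X Y Z = 0) ∧
    -- for ergodic joint samples
    (CausalNet.IsStationaryErgodic P (CausalNet.sample U X Y Z) →
      -- and a prediction model that is continuous in the parameter, has a dominated logarithm,
      -- contains the true conditional law and has a nonempty null model
      ∀ M : CausalNet.PredictionModel (ℝ × (Z → ℝ)) Θ,
      (∀ v, Continuous (fun θ => M.pdf θ v)) →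
      (∃ B : ℝ × ℝ × (Z → ℝ) → ℝ, Integrable B (CausalNet.lawXYZ P U X Y Z) ∧
        ∀ᵐ v ∂(CausalNet.lawXYZ P U X Y Z), ∀ θ, 0 < M.pdf θ v ∧ |Real.log (M.pdf θ v)| ≤ B v) →
      (∃ θs : Θ, ∀ᵐ v ∂(CausalNet.lawXYZ P U X Y Z),
        M.pdf θs v = CausalNet.condDensity (CausalNet.lawXYZ P U X Y Z) v) →
      (CausalNet.nullSet M (CausalNet.lawYZ P U Y Z)).Nonempty →
      -- with maximum likelihood estimators in the null model and in the full model
      ∀ θ₀ θ₁ : ℕ → Ω → Θ,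
      (∀ᵐ ω ∂P, ∀ k, CausalNet.IsMLE M (CausalNet.lawYZ P U Y Z)
        (fun m => CausalNet.sample U X Y Z m ω) k
        (CausalNet.nullSet M (CausalNet.lawYZ P U Y Z)) (θ₀ k ω)) →
      (∀ᵐ ω ∂P, ∀ k, CausalNet.IsMLE M (CausalNet.lawYZ P U Y Z)
        (fun m => CausalNet.sample U X Y Z m ω) k Set.univ (θ₁ k ω)) →
      -- the average log-likelihood converges almost surely
      (∀ θ, ∀ᵐ ω ∂P, Tendsto
        (fun k => CausalNet.avgLogLikelihood M (fun m => CausalNet.sample U X Y Z m ω) k θ)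
        atTop (𝓝 (∫ v, Real.log (M.pdf θ v) ∂(CausalNet.lawXYZ P U X Y Z)))) ∧
      (∀ᵐ ω ∂P, Tendsto
        (fun k => CausalNet.avgLogLikelihood M (fun m => CausalNet.sample U X Y Z m ω) k (θ₁ k ω))
        atTop (𝓝 (- CausalNet.condEntropy (CausalNet.lawXYZ P U X Y Z)))) ∧
      -- the predictability exists, and its vanishing is equivalent to zero transfer entropy
      ∃ F : ℝ,
        CausalNet.IsPredictability P M (CausalNet.lawYZ P U Y Z) (CausalNet.sample U X Y Z)
          θ₀ θ₁ F ∧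
        0 ≤ F ∧
        (CausalNet.transferEntropy P U X Y Z = 0 ↔ F = 0) ∧
        -- it is the transfer entropy when the null model contains the true law of `X` given `Z`
        ((∃ θ ∈ CausalNet.nullSet M (CausalNet.lawYZ P U Y Z),
            ∀ᵐ v ∂(CausalNet.lawXYZ P U X Y Z),
              M.pdf θ v = CausalNet.condDensity (CausalNet.lawXZ P U X Z) (v.1, v.2.2)) →
          F = CausalNet.transferEntropy P U X Y Z)) := by
  have := CausalNet.isProbabilityMeasure_lawXYZ P hU X Y Z
  have hskip := CausalNet.skipMiddle_lawXYZ P hU X Y Z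
  -- The time order separates X from Y and from Z, as the Markov and faithfulness conditions require
  -- disjoint sets.
  have hXY : Disjoint ({X} : Finset (ι × ℤ)) {Y} := by
    rw [Finset.disjoint_singleton]
    rintro rfl
    exact lt_irrefl _ hYX
  have hXZ : Disjoint ({X} : Finset (ι × ℤ)) Z :=
    Finset.disjoint_singleton_left.2 fun h => lt_irrefl _ (hZX X h)
  have hYZ' : Disjoint ({Y} : Finset (ι × ℤ)) Z := Finset.disjoint_singleton_left.2 hYZ
  rw [CausalNet.transferEntropy]
  simp only [← hskip] at hHXZ ⊢
  constructor
  · rw [← CausalNet.condIndepLaw_iff_condEntropy_sub_eq_zero _ hac hHXZ hHXYZ,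
      ← CausalNet.condIndepVars_singleton_iff P hU]
    exact ⟨hMarkov _ _ _ hXY hXZ hYZ', hFaithful _ _ _ hXY hXZ hYZ'⟩
  · rintro hSE M hM ⟨B, hB, hMB⟩ ⟨θs, hθs⟩ hne θ₀ θ₁ hθ₀ hθ₁
    exact CausalNet.predictability_of_isStationaryErgodic hSE
      (CausalNet.measurable_sample hU X Y Z) (CausalNet.map_sample_zero P U X Y Z)
      (CausalNet.map_snd_lawXYZ P hU X Y Z) hac hHXZ hHXYZ hM hB hMB hθs hne hθ₀ hθ₁
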